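/- **Setting.** Let $I=[0,1]$ and let $\tau:I\to I$ be piecewise monotonic with associated partition $C=\{0=a_0<a_1<\dots<a_n=1\}$, i.e. $\tau$ is continuous and strictly monotonic on each $(a_{i-1},a_i)$ (the partition need not be maximal). Let $\tau_i$ be the continuous extension of $\tau|_{(a_{i-1},a_i)}$ to $[a_{i-1},a_i]$. For $x\in I$ let $\widehat\tau(x)$ be the set of left and right limits of $\tau$ at $x$; put $\widehat\tau(S)=\bigcup_{x\in S}\widehat\tau(x)$ and $\widehat\tau^{-1}(S)=\{x:\widehat\tau(x)\cap S\neq\emptyset\}$. Let $I_1$ be the smallest subset of $I$ that contains $C$ and is closed under $\widehat\tau$ and $\widehat\tau^{-1}$, and $I_0=I\setminus I_1$. Let $X$ be the totally ordered set obtained from $I$ by replacing each $x\in I_1\setminus\{0,1\}$ by two points $x^-<x^+$ (for every other $x$ write $x^-=x^+$ for the one point over $x$), with the order topology, and let $\pi:X\to I$ be the collapse map. Let $\sigma:X\to X$ be the associated local homeomorphism: the unique continuous map with $\pi\circ\sigma=\tau\circ\pi$ on $\pi^{-1}(I_0)$. Explicitly, on $[a_{i-1}^+,a_i^-]_X$ it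 is $x^\pm\mapsto\tau_i(x)^\pm$ if $\tau$ increases on $(a_{i-1},a_i)$ and $x^\pm\mapsto\tau_i(x)^\mp$ if $\tau$ decreases there, where in this formula the point $0$ is read as $0^+$ and the point $1$ as $1^-$. Assume that $\tau$ is Markov, with Markov partition $0=b_0<b_1<\dots<b_q=1$: each $b_i\in I_1$; $\tau$ is monotonic on each $(b_{i-1},b_i)$; each $\overline{\tau((b_{i-1},b_i))}$ is a union of intervals of the form $[b_{j-1},b_j]$; and $\widehat\tau^k(C)\subset\{b_0,\dots,b_q\}$ for some $k\ge0$. Let $E_i=[b_{i-1}^+,b_i^-]_X$ for $1\le i\le q$ (these sets partition $X$), and let $A$ be the $q\times q$ zero-one incidence matrix, with $A_{ij}=1$ iff $\sigma(E_i)\supset E_j$. The itinerary of $x\in X$ is the sequence $S(x)=s_0s_1s_2\dots$ with $\sigma^k(x)\in E_{s_k}$ for all $k\ge0$. Let $X_A$ be the space of sequences $x_0x_1x_2\dots$ in $\{1,\dots,q\}$ with $A_{x_kx_{k+1}}=1$ for all $k\ge 0$ (topology induced by the product of discrete topologies), and $\sigma_A$ the left shift on $X_A$. A homterval for $\tau$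 is a non-empty open interval $J\subset I$ such that for every $n\ge0$ the map $\tau^n$ restricts to a homeomorphism of $J$ onto $\tau^n(J)$. **Proposition.** The following are equivalent: 1. $\tau$ has no homtervals. 2. Itineraries separate the points of $X$, i.e. $x\mapsto S(x)$ is injective on $X$. 3. $(X,\sigma)$ is conjugate to $(X_A,\sigma_A)$, i.e. there is a homeomorphism $h:X\to X_A$ with $h\circ\sigma=\sigma_A\circ h$. Moreover, these conditions all hold if $\tau$ is transitive, i.e. if, with $\tau$ viewed as undefined on $C$, for each pair $U,V$ of non-empty open subsets of $I$ there is $n\ge0$ with $\tau^n(U)\cap V\neq\emptyset$ (that is, some $x\in U$ has $\tau^kx\notin C$ for $0\le k<n$ and $\tau^nx\in V$). -/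

import Mathlib

open Set Filter Topology

noncomputable section

namespace IntervalMap

/-! ### Partitions of the unit interval and piecewise monotonic maps -/

/-- A partition `0 = b₀ < b₁ < ⋯ < bₙ = 1` of the unit interval. -/
structure IntervalPartition (n : ℕ) where
  pt : Fin (n + 1) → unitInterval
  strictMono : StrictMono pt
  zero : pt 0 = 0
  last : pt (Fin.last n) = 1

/-- The `i`-th open partition interval `(bᵢ, bᵢ₊₁)`. -/
def IntervalPartition.openPiece {n : ℕ} (b : IntervalPartition n) (i : Fin n) :
    Set unitInterval :=
  Ioo (b.pt i.castSucc) (b.pt i.succ)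

/-- The `i`-th closed partition interval `[bᵢ, bᵢ₊₁]`. -/
def IntervalPartition.closedPiece {n : ℕ} (b : IntervalPartition n) (i : Fin n) :
    Set unitInterval :=
  Icc (b.pt i.castSucc) (b.pt i.succ)

/-- A piecewise monotonic structure on `τ : [0,1] → [0,1]`: a finite partition such that `τ` is
continuous and strictly monotonic on each open partition interval. No condition is put on the
values of `τ` at the partition points, and the partition need not be maximal. -/
structure MonotonicPartition (τ : unitInterval → unitInterval) where
  n : ℕ
  part : IntervalPartition n
  continuousOn : ∀ i, ContinuousOn τ (part.openPiece i)
  strictMonotonic : ∀ i,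
    StrictMonoOn τ (part.openPiece i) ∨ StrictAntiOn τ (part.openPiece i)

/-! ### The multivalued map `τ̂` and generalized orbits -/

/-- `τ̂(x)`: the set of left and right limits of `τ` at `x` (only the right limit at `0`, only the
left limit at `1`). -/
def hat (τ : unitInterval → unitInterval) (x : unitInterval) : Set unitInterval :=
  {y | ((𝓝[<] x).NeBot ∧ Tendsto τ (𝓝[<] x) (𝓝 y)) ∨
       ((𝓝[>] x).NeBot ∧ Tendsto τ (𝓝[>] x) (𝓝 y))}

/-- `τ̂(S) = ⋃_{x ∈ S} τ̂(x)`. -/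
def hatImage (τ : unitInterval → unitInterval) (S : Set unitInterval) : Set unitInterval :=
  ⋃ x ∈ S, hat τ x

/-- `τ̂⁻¹(S) = {x | τ̂(x) ∩ S ≠ ∅}`. -/
def hatPreimage (τ : unitInterval → unitInterval) (S : Set unitInterval) : Set unitInterval :=
  {x | (hat τ x ∩ S).Nonempty}

/-- The generalized orbit of `C`: the smallest set containing `C` and closed under `τ̂` and
`τ̂⁻¹`. -/
def generalizedOrbit (τ : unitInterval → unitInterval) (C : Set unitInterval) :
    Set unitInterval :=
  ⋂₀ {S | C ⊆ S ∧ hatImage τ S ⊆ S ∧ hatPreimage τ S ⊆ S}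

/-! ### Disconnecting the interval -/

/-- The disconnection of `[0,1]` at the points of `S`: every `x ∈ S \ {0,1}` is replaced by two
points `x⁻ = (x, false) < x⁺ = (x, true)`. Every other point occurs exactly once; its tag is
immaterial for the order, and is `true` for the point `0` (which is only approached from
the right) and `false` otherwise. -/
def Disconnection (S : Set unitInterval) : Type :=
  {p : unitInterval ×ₗ Bool //
    (ofLex p).1 ∈ S \ {0, 1} ∨ ((ofLex p).2 = true ↔ (ofLex p).1 = 0)}

/-- The (lexicographic) total order of the disconnection. -/
instance (S : Set unitInterval) : LinearOrder (Disconnection S) :=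
  inferInstanceAs (LinearOrder {p : unitInterval ×ₗ Bool //
    (ofLex p).1 ∈ S \ {0, 1} ∨ ((ofLex p).2 = true ↔ (ofLex p).1 = 0)})

/-- The disconnection carries the order topology. -/
instance (S : Set unitInterval) : TopologicalSpace (Disconnection S) :=
  Preorder.topology _

instance (S : Set unitInterval) : OrderTopology (Disconnection S) := ⟨rfl⟩

namespace Disconnection

variable {S : Set unitInterval}

/-- The collapse map `π`. -/
def collapse (p : Disconnection S) : unitInterval := (ofLex p.1).1

/-- The tag of a point: `true` for `x⁺`, `false` for `x⁻`. -/
def tag (p : Disconnection S) : Bool := (ofLex p.1).2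

open Classical in
/-- `side true x = x⁺` and `side false x = x⁻`; both are the unique preimage of `x` under the
collapse map if `x ∉ S \ {0,1}`. -/
def side (s : Bool) (x : unitInterval) : Disconnection S :=
  if h : x ∈ S \ {0, 1} then ⟨toLex (x, s), Or.inl h⟩
  else ⟨toLex (x, decide (x = 0)), Or.inr (by simp)⟩

theorem side_of_mem {x : unitInterval} (s : Bool) (h : x ∈ S \ {0, 1}) :
    side s x = (⟨toLex (x, s), Or.inl h⟩ : Disconnection S) := dif_pos h

open Classical in
theorem side_of_notMem {x : unitInterval} (s : Bool) (h : x ∉ S \ {0, 1}) :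
    side s x = (⟨toLex (x, decide (x = 0)), Or.inr (by simp)⟩ : Disconnection S) := dif_neg h

theorem lt_iff {p q : Disconnection S} :
    p < q ↔ p.collapse < q.collapse ∨ p.collapse = q.collapse ∧ p.tag < q.tag :=
  Prod.Lex.lt_iff (x := p.1) (y := q.1)

theorem le_iff {p q : Disconnection S} :
    p ≤ q ↔ p.collapse < q.collapse ∨ p.collapse = q.collapse ∧ p.tag ≤ q.tag :=
  Prod.Lex.le_iff (x := p.1) (y := q.1)

theorem mem_or_tag (p : Disconnection S) :
    p.collapse ∈ S \ {0, 1} ∨ (p.tag = true ↔ p.collapse = 0) := p.2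

theorem collapse_side (s : Bool) (x : unitInterval) :
    (side s x : Disconnection S).collapse = x := by
  by_cases h : x ∈ S \ {0, 1}
  · rw [side_of_mem s h]; rfl
  · rw [side_of_notMem s h]; rfl

theorem side_true_le_of_side_false_lt {t : unitInterval} {x : Disconnection S}
    (h : side false t < x) : side true t ≤ x := by
  by_cases ht : t ∈ S \ {0, 1}
  · rw [lt_iff, collapse_side] at h
    rw [le_iff, collapse_side]
    rcases h with h | ⟨h1, h2⟩
    · exact Or.inl h
    · refine Or.inr ⟨h1, ?_⟩
      rw [side_of_mem _ ht] at h2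
      have : x.tag = true := by
        cases hx : x.tag
        · rw [hx] at h2; exact absurd h2 (by simp [Bool.lt_iff])
        · rfl
      rw [this]; exact Bool.le_true _
  · rw [side_of_notMem _ ht] at h ⊢
    exact h.le

theorem side_true_zero_le (x : Disconnection S) : side true 0 ≤ x := by
  rw [le_iff, collapse_side]
  by_cases hx : x.collapse = 0
  · refine Or.inr ⟨hx.symm, ?_⟩
    have : x.tag = true := by
      rcases x.mem_or_tag with h | h
      · exact absurd (Or.inl hx) h.2
      · exact h.2 hx
    rw [this]; exact Bool.le_true _
  · exact Or.inl (lt_of_le_of_ne unitInterval.nonneg' (Ne.symm hx))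

theorem le_side_false_one (x : Disconnection S) : x ≤ side false 1 := by
  rw [le_iff, collapse_side]
  by_cases hx : x.collapse = 1
  · refine Or.inr ⟨hx, ?_⟩
    have : x.tag = false := by
      rcases x.mem_or_tag with h | h
      · exact absurd (Or.inr hx) h.2
      · cases ht : x.tag
        · rfl
        · exact absurd ((h.1 ht).symm.trans hx) zero_ne_one
    rw [this]; exact Bool.false_le _
  · exact Or.inl (lt_of_le_of_ne unitInterval.le_one' hx)

/-- The order interval `[bᵢ⁺, bᵢ₊₁⁻]` in the disconnection. -/
def cell {n : ℕ} (b : IntervalPartition n) (i : Fin n) : Set (Disconnection S) :=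
  Icc (side true (b.pt i.castSucc)) (side false (b.pt i.succ))

theorem exists_mem_cell {n : ℕ} (b : IntervalPartition n) (x : Disconnection S) :
    ∃ i, x ∈ cell b i := by
  by_contra! hc
  have key : ∀ i : Fin (n + 1), side true (b.pt i) ≤ x := by
    intro i
    induction i using Fin.induction with
    | zero => rw [b.zero]; exact side_true_zero_le x
    | succ i ih =>
      exact side_true_le_of_side_false_lt (not_le.1 fun h => hc i ⟨ih, h⟩)
  rcases n with _ | n
  · have h0 := b.zero
    have h1 := b.last
    rw [show Fin.last 0 = 0 from rfl, h0] at h1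
    exact zero_ne_one h1
  · refine hc (Fin.last n) ⟨key _, ?_⟩
    rw [Fin.succ_last, b.last]
    exact le_side_false_one x

/-- The index `i` with `x ∈ [bᵢ⁺, bᵢ₊₁⁻]` (it is unique when all `bᵢ` belong to `S`). -/
def cellIndex {n : ℕ} (b : IntervalPartition n) (x : Disconnection S) : Fin n :=
  (exists_mem_cell b x).choose

theorem mem_cell_cellIndex {n : ℕ} (b : IntervalPartition n) (x : Disconnection S) :
    x ∈ cell b (cellIndex b x) :=
  (exists_mem_cell b x).choose_spec

end Disconnection

namespace MonotonicPartition

variable {τ : unitInterval → unitInterval} (P : MonotonicPartition τ)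

/-- The set `C` of endpoints of the intervals of monotonicity. -/
def endpoints : Set unitInterval := range P.part.pt

/-- `I₁`, the generalized orbit of `C`. -/
def orbitSet : Set unitInterval := generalizedOrbit τ P.endpoints

/-- The space `X`: the disconnection of `[0,1]` at the points of `I₁`. -/
abbrev Space : Type := Disconnection P.orbitSet

/-- `τᵢ`: the continuous extension of `τ` from `(aᵢ, aᵢ₊₁)` to `[aᵢ, aᵢ₊₁]`. -/
def branch (i : Fin P.n) : unitInterval → unitInterval :=
  extendFrom (P.part.openPiece i) τ

open Classical in
/-- The local homeomorphism `σ : X → X` associated with `τ`: for a point `x^±` of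
`[aᵢ⁺, aᵢ₊₁⁻]`, its value is `τᵢ(x)^±` if `τ` is increasing on `(aᵢ, aᵢ₊₁)`, and `τᵢ(x)^∓` if
`τ` is decreasing there. It is the unique continuous map of `X` with `π ∘ σ = τ ∘ π` on
`π⁻¹([0,1] \ I₁)`. -/
def localHomeo (x : P.Space) : P.Space :=
  let i := Disconnection.cellIndex P.part x
  Disconnection.side (if StrictMonoOn τ (P.part.openPiece i) then x.tag else !x.tag)
    (P.branch i x.collapse)

/-- Transitivity of `τ`, regarded as undefined on `C`: for nonempty open `U, V` there is `n ≥ 0`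
such that `τⁿ(U)` meets `V`. -/
def IsTransitive : Prop :=
  ∀ U V : Set unitInterval, IsOpen U → IsOpen V → U.Nonempty → V.Nonempty →
    ∃ n : ℕ, ∃ x ∈ U, (∀ k < n, τ^[k] x ∉ P.endpoints) ∧ τ^[n] x ∈ V

end MonotonicPartition

/-- `J` is a homterval for `τ`: a nonempty open interval on which every `τⁿ` is a homeomorphism
(onto its image). -/
def IsHomterval (τ : unitInterval → unitInterval) (J : Set unitInterval) : Prop :=
  (∃ u v : unitInterval, u < v ∧ J = Ioo u v) ∧ ∀ n : ℕ, IsEmbedding (J.domRestrict τ^[n])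

/-! ### Markov partitions -/

/-- A Markov partition for the piecewise monotonic map `τ`. -/
structure MarkovPartition {τ : unitInterval → unitInterval} (P : MonotonicPartition τ) where
  m : ℕ
  part : IntervalPartition m
  mem_orbitSet : ∀ i, part.pt i ∈ P.orbitSet
  monotonic : ∀ i, MonotoneOn τ (part.openPiece i) ∨ AntitoneOn τ (part.openPiece i)
  closure_image : ∀ i, ∃ s : Set (Fin m),
    closure (τ '' part.openPiece i) = ⋃ j ∈ s, part.closedPiece j
  eventually_mem : ∃ k : ℕ, (hatImage τ)^[k] P.endpoints ⊆ range part.pt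

namespace MarkovPartition

variable {τ : unitInterval → unitInterval} {P : MonotonicPartition τ} (M : MarkovPartition P)

/-- The sets `Eᵢ = [bᵢ⁺, bᵢ₊₁⁻]`, which form the associated Markov partition for `σ`. -/
def cell (i : Fin M.m) : Set P.Space := Disconnection.cell M.part i

open Classical in
/-- The incidence matrix: `Aᵢⱼ = 1` if `σ(Eᵢ) ⊇ Eⱼ`, and `Aᵢⱼ = 0` otherwise. -/
def incidence : Matrix (Fin M.m) (Fin M.m) ℕ :=
  Matrix.of fun i j => if M.cell j ⊆ P.localHomeo '' M.cell i then 1 else 0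

/-- The itinerary `s₀s₁s₂…` of `x`, given by `σᵏ(x) ∈ E_{sₖ}`. -/
def itinerary (x : P.Space) : ℕ → Fin M.m :=
  fun k => Disconnection.cellIndex M.part (P.localHomeo^[k] x)

end MarkovPartition

/-! ### One-sided shifts of finite type -/

/-- `X_A`: the one-sided sequences all of whose transitions are allowed by `A`, with the topology
induced by the product of the discrete topologies. -/
abbrev ShiftSpace {m : ℕ} (A : Matrix (Fin m) (Fin m) ℕ) : Type :=
  {s : ℕ → Fin m // ∀ k, A (s k) (s (k + 1)) = 1}

/-- `σ_A`: the left shift on `X_A`. -/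
def shift {m : ℕ} (A : Matrix (Fin m) (Fin m) ℕ) (s : ShiftSpace A) : ShiftSpace A :=
  ⟨fun k => s.1 (k + 1), fun k => s.2 (k + 1)⟩

/-- Topological conjugacy of the systems `(Y, f)` and `(Z, g)`. -/
def IsConjugate {Y Z : Type*} [TopologicalSpace Y] [TopologicalSpace Z]
    (f : Y → Y) (g : Z → Z) : Prop :=
  ∃ h : Y ≃ₜ Z, Function.Semiconj h f g

end IntervalMap

end

namespace IntervalMap

/-! ### The order and the topology of a disconnection -/

namespace Disconnection

variable {S : Set unitInterval}

/-! Everything reduces to one fact: the set I₁ of split points, `P.orbitSet`, is dense in [0,1].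

Since I₁ is closed under τ̂⁻¹ and contains C, the orbit of a gap of I₁ avoids C. All iterates are
then continuous and strictly monotonic there, so the gap is a homterval
(`dense_of_not_exists_isHomterval`). Conversely, every point of I₁ eventually lands in the finite
Markov partition; if I₁ is dense, some iterate would send more points of a homterval there,
injectively, than there is room for (`not_exists_isHomterval_of_dense`).

If I₁ is dense, two distinct points of X with the same itinerary enclose a pair t⁻ < t⁺, which then
has that itinerary too. By the Markov property (`cell_subset_image`), σ keeps such a pair adjacent
while its itineraries agree; but it eventually lies over a Markov partition point, whose two copies
are in different cells (`itinerary_side_ne`). Once injective, the itinerary map is a continuous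
bijection of the compact space X onto X_A. A conjugacy makes X totally disconnected, which excludes
gaps of I₁.

If τ is transitive and I₁ has a gap, a component K of the complement is mapped into itself by some
τ^p, p > 0. For the least p every return time is a multiple of p, and a strictly monotonic self-map
of an interval is not transitive (`IsTransitive.dense_orbitSet`). -/

theorem ext_collapse_tag {p q : Disconnection S} (h : p.collapse = q.collapse)
    (h' : p.tag = q.tag) : p = q :=
  Subtype.ext (ofLex.injective (Prod.ext h h'))

theorem tag_side {t : unitInterval} (s : Bool) (h : t ∈ S \ {0, 1}) :
    (side s t : Disconnection S).tag = s := by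
  rw [side_of_mem s h]; rfl

theorem eq_of_collapse_notMem {p q : Disconnection S} (h : p.collapse = q.collapse)
    (hp : p.collapse ∉ S \ {0, 1}) : p = q := by
  refine ext_collapse_tag h ?_
  have h1 := p.mem_or_tag.resolve_left hp
  have h2 := q.mem_or_tag.resolve_left (h ▸ hp)
  rw [← h, ← h1] at h2
  exact Bool.eq_iff_iff.2 h2.symm

theorem side_tag_collapse (p : Disconnection S) : side p.tag p.collapse = p := by
  by_cases h : p.collapse ∈ S \ {0, 1}
  · exact ext_collapse_tag (collapse_side _ _) (tag_side _ h)
  · exact (eq_of_collapse_notMem (collapse_side _ _).symm h).symm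

theorem side_collapse_of_notMem (s : Bool) {p : Disconnection S} (hp : p.collapse ∉ S \ {0, 1}) :
    side s p.collapse = p :=
  (eq_of_collapse_notMem (collapse_side _ _).symm hp).symm

theorem lt_of_collapse_lt {p q : Disconnection S} (h : p.collapse < q.collapse) : p < q :=
  lt_iff.2 (Or.inl h)

theorem collapse_mono : Monotone (collapse : Disconnection S → unitInterval) := by
  intro p q h
  rcases le_iff.1 h with h | h
  · exact h.le
  · exact h.1.le

theorem side_strictMono (s : Bool) : StrictMono (side s : unitInterval → Disconnection S) := by
  intro t u h
  exact lt_of_collapse_lt (by simpa only [collapse_side] using h)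

theorem side_false_lt_side_true {t : unitInterval} (h : t ∈ S \ {0, 1}) :
    (side false t : Disconnection S) < side true t := by
  rw [lt_iff, collapse_side, collapse_side, tag_side _ h, tag_side _ h]
  exact Or.inr ⟨rfl, rfl⟩

theorem side_false_le_side_true (t : unitInterval) :
    (side false t : Disconnection S) ≤ side true t := by
  by_cases h : t ∈ S \ {0, 1}
  · exact (side_false_lt_side_true h).le
  · exact (eq_of_collapse_notMem (by simp only [collapse_side]) (by rwa [collapse_side])).le

theorem eq_side_true_of_ge {p : Disconnection S} {t : unitInterval} (h : side true t ≤ p)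
    (ht : p.collapse = t) : p = side true t := by
  subst ht
  by_cases hm : p.collapse ∈ S \ {0, 1}
  · refine ext_collapse_tag (collapse_side _ _).symm ?_
    rcases le_iff.1 h with h | h
    · rw [collapse_side] at h; exact absurd h (lt_irrefl _)
    · rw [tag_side _ hm] at h ⊢
      exact le_antisymm (Bool.le_true _) h.2
  · exact (side_collapse_of_notMem _ hm).symm

theorem eq_side_false_of_le {p : Disconnection S} {t : unitInterval} (h : p ≤ side false t)
    (ht : p.collapse = t) : p = side false t := by
  subst ht
  by_cases hm : p.collapse ∈ S \ {0, 1}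
  · refine ext_collapse_tag (collapse_side _ _).symm ?_
    rcases le_iff.1 h with h | h
    · rw [collapse_side] at h; exact absurd h (lt_irrefl _)
    · rw [tag_side _ hm] at h ⊢
      exact le_antisymm h.2 (Bool.false_le _)
  · exact (side_collapse_of_notMem _ hm).symm

theorem side_false_collapse_le (p : Disconnection S) : side false p.collapse ≤ p := by
  by_contra! h
  have := eq_side_false_of_le h.le rfl
  exact h.ne this

theorem le_side_true_collapse (p : Disconnection S) : p ≤ side true p.collapse := by
  by_contra! h
  have := eq_side_true_of_ge h.le rfl
  exact h.ne' this

/-- Two comparable points over the same point are `t⁻ < t⁺` with `t` a split point. -/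
theorem eq_side_of_lt {p q : Disconnection S} (h : p < q) (hc : p.collapse = q.collapse) :
    p.collapse ∈ S \ {0, 1} ∧ p = side false p.collapse ∧ q = side true p.collapse := by
  have hm : p.collapse ∈ S \ {0, 1} := by
    by_contra hm
    exact h.ne (eq_of_collapse_notMem hc hm)
  rcases lt_iff.1 h with h' | h'
  · exact absurd hc h'.ne
  · have h2 := Bool.lt_iff.1 h'.2
    refine ⟨hm, ?_, ?_⟩
    · rw [← h2.1, side_tag_collapse]
    · rw [← h2.2, hc, side_tag_collapse]

theorem side_false_covBy_side_true {t : unitInterval} (h : t ∈ S \ {0, 1}) :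
    (side false t : Disconnection S) ⋖ side true t :=
  ⟨side_false_lt_side_true h, fun _ h1 h2 => h2.not_ge (side_true_le_of_side_false_lt h1)⟩

theorem collapse_eq_of_covBy {p q : Disconnection S} (h : p ⋖ q) : p.collapse = q.collapse := by
  by_contra hne
  obtain ⟨t, h1, h2⟩ := exists_between (lt_of_le_of_ne (collapse_mono h.1.le) hne)
  exact h.2 (c := side true t) (lt_of_collapse_lt (by rwa [collapse_side]))
    (lt_of_collapse_lt (by rwa [collapse_side]))

/-- Each point has a side on which it is approached by other points of X; neighbourhoods are
examined on that side. -/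
theorem eq_side_true_or_eq_side_false (p : Disconnection S) :
    (p.collapse < 1 ∧ p = side true p.collapse) ∨ (0 < p.collapse ∧ p = side false p.collapse) := by
  by_cases hm : p.collapse ∈ S \ {0, 1}
  · cases ht : p.tag
    · exact Or.inr ⟨unitInterval.pos_iff_ne_zero.2 fun h => hm.2 (Or.inl h),
        by rw [← ht, side_tag_collapse]⟩
    · exact Or.inl ⟨unitInterval.lt_one_iff_ne_one.2 fun h => hm.2 (Or.inr h),
        by rw [← ht, side_tag_collapse]⟩
  · by_cases h : p.collapse = 0
    · exact Or.inl ⟨by rw [h]; exact zero_lt_one, (side_collapse_of_notMem _ hm).symm⟩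
    · exact Or.inr ⟨unitInterval.pos_iff_ne_zero.2 h, (side_collapse_of_notMem _ hm).symm⟩

/-- Nonempty open sets contain the preimage of a nondegenerate open interval. -/
theorem exists_preimage_Ioo_subset {W : Set (Disconnection S)} (hW : IsOpen W)
    (hne : W.Nonempty) : ∃ u v : unitInterval, u < v ∧ collapse ⁻¹' Ioo u v ⊆ W := by
  obtain ⟨p, hp⟩ := hne
  rcases eq_side_true_or_eq_side_false p with ⟨h1, h2⟩ | ⟨h1, h2⟩
  · obtain ⟨q, hq, hqW⟩ := exists_Ico_subset_of_mem_nhds (hW.mem_nhds hp)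
      ⟨side true 1, lt_of_collapse_lt (by rwa [collapse_side])⟩
    -- Nothing above x⁺ lies over x, so the one-sided neighbourhood reaches over a nondegenerate
    -- interval.
    have hlt : p.collapse < q.collapse := by
      refine lt_of_le_of_ne (collapse_mono hq.le) fun h => hq.ne ?_
      rw [h2] at hq
      rw [h2, eq_side_true_of_ge hq.le h.symm]
    exact ⟨_, _, hlt, fun x hx => hqW ⟨(lt_of_collapse_lt hx.1).le, lt_of_collapse_lt hx.2⟩⟩
  · obtain ⟨q, hq, hqW⟩ := exists_Ioc_subset_of_mem_nhds (hW.mem_nhds hp)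
      ⟨side true 0, lt_of_collapse_lt (by rwa [collapse_side])⟩
    have hlt : q.collapse < p.collapse := by
      refine lt_of_le_of_ne (collapse_mono hq.le) fun h => hq.ne ?_
      rw [h2] at hq
      rw [h2, eq_side_false_of_le hq.le h]
    exact ⟨_, _, hlt, fun x hx => hqW ⟨lt_of_collapse_lt hx.1, (lt_of_collapse_lt hx.2).le⟩⟩

/-! ### Compactness and total disconnectedness of the disconnection -/

theorem exists_isLUB (A : Set (Disconnection S)) : ∃ p, IsLUB A p := by
  set t := sSup (collapse '' A)
  have hle : ∀ a ∈ A, a.collapse ≤ t := fun a ha => le_sSup (mem_image_of_mem _ ha)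
  have hge : ∀ u ∈ upperBounds A, t ≤ u.collapse := by
    intro u hu
    refine sSup_le ?_
    rintro _ ⟨a, ha, rfl⟩
    exact collapse_mono (hu ha)
  -- Over the supremum t of the collapsed set, the least upper bound is t⁻ if that is a bound, and
  -- otherwise t⁺.
  by_cases h : side false t ∈ upperBounds A
  · refine ⟨_, h, fun u hu => ?_⟩
    exact ((side_strictMono false).monotone (hge u hu)).trans (side_false_collapse_le u)
  · simp only [mem_upperBounds, not_forall, not_le] at h
    obtain ⟨a, ha, hlt⟩ := h
    refine ⟨side true t, fun b hb => ?_, fun u hu => ?_⟩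
    · exact (le_side_true_collapse b).trans ((side_strictMono true).monotone (hle b hb))
    · exact (side_true_le_of_side_false_lt hlt).trans (hu ha)

theorem bddAbove_of_set (A : Set (Disconnection S)) : BddAbove A :=
  ⟨side false 1, fun x _ => le_side_false_one x⟩

theorem bddBelow_of_set (A : Set (Disconnection S)) : BddBelow A :=
  ⟨side true 0, fun x _ => side_true_zero_le x⟩

instance : CompactSpace (Disconnection S) := by
  classical
  choose f hf using fun A : Set (Disconnection S) => exists_isLUB A
  let : SupSet (Disconnection S) := ⟨f⟩
  let L : Lattice (Disconnection S) := inferInstance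
  let : ConditionallyCompleteLinearOrder (Disconnection S) :=
    { (inferInstance : LinearOrder (Disconnection S)), L,
      conditionallyCompleteLatticeOfLatticeOfsSup (Disconnection S) fun s _ _ => hf s with
      -- The default values for unbounded sets are irrelevant: X has a least and a greatest element.
      csSup_of_not_bddAbove := fun s h => absurd (bddAbove_of_set s) h
      csInf_of_not_bddBelow := fun s h => absurd (bddBelow_of_set s) h }
  refine ⟨?_⟩
  have h : Icc (side true 0 : Disconnection S) (side false 1) = univ :=
    eq_univ_of_forall fun x => ⟨side_true_zero_le x, le_side_false_one x⟩
  rw [← h]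
  exact isCompact_Icc

/-- A totally disconnected disconnection splits a dense set of points. -/
theorem dense_of_totallyDisconnectedSpace [TotallyDisconnectedSpace (Disconnection S)] :
    Dense S := by
  refine dense_iff_inter_open.2 fun U hU hne => ?_
  obtain ⟨u, v, huv, hsub⟩ := hU.exists_Ioo_subset hne
  by_contra hemp
  have hnot : ∀ t ∈ Ioo u v, t ∉ S := fun t ht htS => hemp ⟨t, hsub ht, htS⟩
  -- Over an interval without split points the section of the collapse map is strictly monotone with
  -- convex range, hence an embedding, which puts a nontrivial connected set into X.
  let f : Ioo u v → Disconnection S := fun t => side false t.1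
  have hf : StrictMono f := fun t t' h => side_strictMono false h
  have hr : range f = collapse ⁻¹' Ioo u v := by
    ext p
    constructor
    · rintro ⟨t, rfl⟩
      simpa only [mem_preimage, f, collapse_side] using t.2
    · intro hp
      exact ⟨⟨_, hp⟩, side_collapse_of_notMem _ fun h => hnot _ hp h.1⟩
  have : OrdConnected (range f) := by
    rw [hr]; exact ordConnected_Ioo.preimage_mono collapse_mono
  have hcont := (hf.isEmbedding_of_ordConnected (hc := this)).continuous
  have : PreconnectedSpace (Ioo u v) := Subtype.preconnectedSpace isPreconnected_Ioo
  have hsubs := (isPreconnected_range hcont).subsingleton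
  obtain ⟨x, hx⟩ := exists_between huv
  obtain ⟨y, hy⟩ := exists_between hx.2
  have := hsubs ⟨⟨x, hx⟩, rfl⟩ ⟨⟨y, hx.1.trans hy.1, hy.2⟩, rfl⟩
  exact hy.1.ne (congrArg Subtype.val (hf.injective this))

/-! ### Cells -/

section cell

variable {n : ℕ} {b : IntervalPartition n}

theorem collapse_mem_closedPiece {i : Fin n} {p : Disconnection S} (h : p ∈ cell b i) :
    p.collapse ∈ b.closedPiece i := by
  have h1 := collapse_mono h.1
  have h2 := collapse_mono h.2
  rw [collapse_side] at h1 h2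
  exact ⟨h1, h2⟩

theorem mem_cell_of_collapse_mem {i : Fin n} {p : Disconnection S}
    (h : p.collapse ∈ b.openPiece i) : p ∈ cell b i :=
  ⟨(lt_of_collapse_lt (by rw [collapse_side]; exact h.1)).le,
    (lt_of_collapse_lt (by rw [collapse_side]; exact h.2)).le⟩

theorem pt_castSucc_lt_pt_succ (b : IntervalPartition n) (i : Fin n) :
    b.pt i.castSucc < b.pt i.succ :=
  b.strictMono (Fin.castSucc_lt_succ)

theorem side_true_pt_mem_cell (i : Fin n) :
    (side true (b.pt i.castSucc) : Disconnection S) ∈ cell b i :=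
  ⟨le_rfl, (lt_of_collapse_lt (by
    simpa only [collapse_side] using pt_castSucc_lt_pt_succ b i)).le⟩

theorem side_false_pt_mem_cell (i : Fin n) :
    (side false (b.pt i.succ) : Disconnection S) ∈ cell b i :=
  ⟨(lt_of_collapse_lt (by
    simpa only [collapse_side] using pt_castSucc_lt_pt_succ b i)).le, le_rfl⟩

/-- This is where splitting the partition points matters: consecutive cells are separated by a jump
b⁻ < b⁺, so cells are disjoint. -/
theorem side_pt_lt_side_pt (hb : ∀ i, b.pt i ∈ S) {i j : Fin n} (hij : i < j) :
    (side false (b.pt i.succ) : Disconnection S) < side true (b.pt j.castSucc) := by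
  have hle : b.pt i.succ ≤ b.pt j.castSucc :=
    b.strictMono.monotone (Fin.succ_le_castSucc_iff.2 hij)
  refine (side_false_lt_side_true ⟨hb _, ?_⟩).trans_le ((side_strictMono true).monotone hle)
  rintro (h | h)
  · exact (unitInterval.nonneg'.trans_lt (pt_castSucc_lt_pt_succ b i)).ne' h
  · exact ((hle.trans_lt (pt_castSucc_lt_pt_succ b j)).trans_le unitInterval.le_one').ne h

theorem lt_of_mem_cell (hb : ∀ i, b.pt i ∈ S) {i j : Fin n} (hij : i < j)
    {p q : Disconnection S} (hp : p ∈ cell b i) (hq : q ∈ cell b j) : p < q :=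
  (hp.2.trans_lt (side_pt_lt_side_pt hb hij)).trans_le hq.1

theorem cell_unique (hb : ∀ i, b.pt i ∈ S) {i j : Fin n} {p : Disconnection S}
    (hi : p ∈ cell b i) (hj : p ∈ cell b j) : i = j := by
  rcases lt_trichotomy i j with h | h | h
  · exact absurd (lt_of_mem_cell hb h hi hj) (lt_irrefl _)
  · exact h
  · exact absurd (lt_of_mem_cell hb h hj hi) (lt_irrefl _)

theorem cellIndex_eq_iff (hb : ∀ i, b.pt i ∈ S) {i : Fin n} {p : Disconnection S} :
    cellIndex b p = i ↔ p ∈ cell b i :=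
  ⟨fun h => h ▸ mem_cell_cellIndex b p, fun h => cell_unique hb (mem_cell_cellIndex b p) h⟩

/-- The complement is a finite union of closed cells. -/
theorem isOpen_cell (hb : ∀ i, b.pt i ∈ S) (i : Fin n) :
    IsOpen (cell b i : Set (Disconnection S)) := by
  have : (cell b i : Set (Disconnection S)) = (⋃ j ∈ ({i}ᶜ : Set (Fin n)), cell b j)ᶜ := by
    ext p
    simp only [mem_compl_iff, mem_iUnion, not_exists, mem_singleton_iff]
    refine ⟨fun h j hj hp => hj (cell_unique hb hp h), fun h => ?_⟩
    by_contra hp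
    exact h (cellIndex b p) (fun he => hp (he ▸ mem_cell_cellIndex b p)) (mem_cell_cellIndex b p)
  rw [this, isOpen_compl_iff]
  exact (Set.toFinite _).isClosed_biUnion fun j _ => isClosed_Icc

theorem continuous_cellIndex (hb : ∀ i, b.pt i ∈ S) :
    Continuous (cellIndex b : Disconnection S → Fin n) := by
  rw [continuous_discrete_rng]
  intro i
  convert isOpen_cell (S := S) hb i using 1
  ext p
  exact cellIndex_eq_iff hb

/-- Over each of its end points a cell contains only the inner copy. Hence the two copies of a
partition point never share a cell. -/
theorem mem_openPiece_of_side_mem_cell {t : unitInterval} (ht : t ∈ S \ {0, 1}) {i : Fin n}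
    (h1 : (side false t : Disconnection S) ∈ cell b i)
    (h2 : (side true t : Disconnection S) ∈ cell b i) : t ∈ b.openPiece i := by
  have hlt := side_false_lt_side_true ht
  have h3 := collapse_mem_closedPiece h1
  rw [collapse_side] at h3
  refine ⟨lt_of_le_of_ne h3.1 fun h => ?_, lt_of_le_of_ne h3.2 fun h => ?_⟩
  · have := h1.1
    rw [h] at this
    exact this.not_gt hlt
  · have := h2.2
    rw [← h] at this
    exact this.not_gt hlt

theorem pt_notMem_openPiece (k : Fin (n + 1)) (i : Fin n) : b.pt k ∉ b.openPiece i :=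
  fun h => (Fin.castSucc_lt_iff_succ_le.1 (b.strictMono.lt_iff_lt.1 h.1)).not_gt
    (b.strictMono.lt_iff_lt.1 h.2)

end cell

end Disconnection

/-! ### Monotone maps on intervals -/

/-- Continuity extends weak monotonicity to the end points; strictness comes back from two interior
points inserted between x and y. -/
theorem strictMonoOn_Icc_of_Ioo {α β : Type*} [LinearOrder α] [DenselyOrdered α]
    [TopologicalSpace α] [OrderTopology α] [LinearOrder β] [TopologicalSpace β]
    [OrderClosedTopology β] {g : α → β} {a b : α} (hab : a < b)
    (hc : ContinuousOn g (Icc a b)) (hm : StrictMonoOn g (Ioo a b)) :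
    StrictMonoOn g (Icc a b) := by
  have hcl : ∀ t ∈ Icc a b, ∀ s, Ioo a b ⊆ s → ClusterPt t (𝓟 s) := by
    intro t ht s hs
    rw [← mem_closure_iff_clusterPt]
    exact closure_mono hs (by rwa [closure_Ioo hab.ne])
  have h1 : MonotoneOn g (insert b (Ioo a b)) :=
    hm.monotoneOn.insert_of_continuousWithinAt (hcl b (right_mem_Icc.2 hab.le) _ le_rfl)
      ((hc b (right_mem_Icc.2 hab.le)).mono Ioo_subset_Icc_self)
  have h2 : MonotoneOn g (insert a (insert b (Ioo a b))) := by
    refine h1.insert_of_continuousWithinAt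
      (hcl a (left_mem_Icc.2 hab.le) _ (subset_insert _ _))
      ((hc a (left_mem_Icc.2 hab.le)).mono ?_)
    exact insert_subset (right_mem_Icc.2 hab.le) Ioo_subset_Icc_self
  have h3 : Icc a b ⊆ insert a (insert b (Ioo a b)) := fun t ht =>
    eq_endpoints_or_mem_Ioo_of_mem_Icc ht
  intro x hx y hy hxy
  obtain ⟨u, hu⟩ := exists_between hxy
  obtain ⟨v, hv⟩ := exists_between hu.2
  have hu' : u ∈ Ioo a b := ⟨hx.1.trans_lt hu.1, hu.2.trans_le hy.2⟩
  have hv' : v ∈ Ioo a b := ⟨hu'.1.trans hv.1, hv.2.trans_le hy.2⟩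
  calc g x ≤ g u := h2 (h3 hx) (h3 (Ioo_subset_Icc_self hu')) hu.1.le
    _ < g v := hm hu' hv' hv.1
    _ ≤ g y := h2 (h3 (Ioo_subset_Icc_self hv')) (h3 hy) hv.2.le

theorem strictAntiOn_Icc_of_Ioo {α β : Type*} [LinearOrder α] [DenselyOrdered α]
    [TopologicalSpace α] [OrderTopology α] [LinearOrder β] [TopologicalSpace β]
    [OrderClosedTopology β] {g : α → β} {a b : α} (hab : a < b)
    (hc : ContinuousOn g (Icc a b)) (hm : StrictAntiOn g (Ioo a b)) :
    StrictAntiOn g (Icc a b) :=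
  (strictMonoOn_Icc_of_Ioo (β := βᵒᵈ) hab hc hm.dual_right).dual_right

theorem not_strictAntiOn_of_monotoneOn {α β : Type*} [Preorder α] [Preorder β] {f : α → β}
    {s t : Set α} (hf : MonotoneOn f s) (hf' : StrictAntiOn f t) {u v : α} (huv : u < v)
    (hu : u ∈ s ∩ t) (hv : v ∈ s ∩ t) : False :=
  (hf hu.1 hv.1 huv.le).not_gt (hf' hu.2 hv.2 huv)

/-! ### The multivalued map -/

variable {τ : unitInterval → unitInterval}

theorem hatImage_mono {S T : Set unitInterval} (h : S ⊆ T) : hatImage τ S ⊆ hatImage τ T :=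
  biUnion_subset_biUnion_left h

theorem hatPreimage_mono {S T : Set unitInterval} (h : S ⊆ T) :
    hatPreimage τ S ⊆ hatPreimage τ T :=
  fun _ hx => hx.mono (inter_subset_inter_right _ h)

theorem hatImage_singleton (x : unitInterval) : hatImage τ {x} = hat τ x :=
  biUnion_singleton _ _

theorem eq_of_mem_hat {x y : unitInterval} (hx : ContinuousAt τ x) (hy : y ∈ hat τ x) :
    y = τ x := by
  rcases hy with ⟨h1, h2⟩ | ⟨h1, h2⟩
  · exact tendsto_nhds_unique h2 (hx.mono_left nhdsWithin_le_nhds)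
  · exact tendsto_nhds_unique h2 (hx.mono_left nhdsWithin_le_nhds)

theorem nhdsLT_neBot {x y : unitInterval} (h : x < y) : (𝓝[<] y).NeBot :=
  nhdsLT_neBot_of_exists_lt ⟨x, h⟩

theorem nhdsGT_neBot {x y : unitInterval} (h : x < y) : (𝓝[>] x).NeBot :=
  nhdsGT_neBot_of_exists_gt ⟨y, h⟩

theorem self_mem_hat {x : unitInterval} (hx : ContinuousAt τ x) : τ x ∈ hat τ x := by
  rcases (unitInterval.nonneg' (t := x)).eq_or_lt with h | h
  · refine Or.inr ⟨nhdsGT_neBot (y := 1) (h ▸ zero_lt_one), hx.mono_left nhdsWithin_le_nhds⟩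
  · exact Or.inl ⟨nhdsLT_neBot h, hx.mono_left nhdsWithin_le_nhds⟩

theorem subset_generalizedOrbit (C : Set unitInterval) : C ⊆ generalizedOrbit τ C :=
  subset_sInter fun _ h => h.1

theorem hatImage_generalizedOrbit (C : Set unitInterval) :
    hatImage τ (generalizedOrbit τ C) ⊆ generalizedOrbit τ C :=
  subset_sInter fun _ h => (hatImage_mono (sInter_subset_of_mem h)).trans h.2.1

theorem hatPreimage_generalizedOrbit (C : Set unitInterval) :
    hatPreimage τ (generalizedOrbit τ C) ⊆ generalizedOrbit τ C :=
  subset_sInter fun _ h => (hatPreimage_mono (sInter_subset_of_mem h)).trans h.2.2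

theorem generalizedOrbit_subset {C S : Set unitInterval} (h1 : C ⊆ S) (h2 : hatImage τ S ⊆ S)
    (h3 : hatPreimage τ S ⊆ S) : generalizedOrbit τ C ⊆ S :=
  sInter_subset_of_mem ⟨h1, h2, h3⟩

/-! ### The branches of a piecewise monotonic map -/

open Disconnection

theorem exists_mem_openPiece {n : ℕ} (b : IntervalPartition n) {t : unitInterval}
    (ht : t ∉ range b.pt) : ∃ i, t ∈ b.openPiece i := by
  obtain ⟨i, hi⟩ := exists_mem_cell b (side true t : Disconnection ∅)
  have := collapse_mem_closedPiece hi
  rw [collapse_side] at this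
  exact ⟨i, lt_of_le_of_ne this.1 fun h => ht ⟨_, h⟩, lt_of_le_of_ne this.2 fun h => ht ⟨_, h.symm⟩⟩

namespace MonotonicPartition

variable (P : MonotonicPartition τ)

theorem pt_mem_orbitSet (i : Fin (P.n + 1)) : P.part.pt i ∈ P.orbitSet :=
  subset_generalizedOrbit _ (mem_range_self i)

variable {P}

theorem mem_orbitSet_of_mem_hat {x y : unitInterval} (hx : x ∈ P.orbitSet) (hy : y ∈ hat τ x) :
    y ∈ P.orbitSet :=
  hatImage_generalizedOrbit _ (mem_biUnion hx hy)

theorem mem_orbitSet_of_hat_mem {x y : unitInterval} (hx : y ∈ P.orbitSet) (hy : y ∈ hat τ x) :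
    x ∈ P.orbitSet :=
  hatPreimage_generalizedOrbit _ ⟨y, hy, hx⟩

theorem continuousAt_of_mem_openPiece {i : Fin P.n} {t : unitInterval}
    (ht : t ∈ P.part.openPiece i) : ContinuousAt τ t :=
  (P.continuousOn i).continuousAt (isOpen_Ioo.mem_nhds ht)

theorem continuousAt_of_notMem {t : unitInterval} (ht : t ∉ P.endpoints) : ContinuousAt τ t := by
  obtain ⟨i, hi⟩ := exists_mem_openPiece P.part ht
  exact continuousAt_of_mem_openPiece hi

theorem branch_eq_of_mem {i : Fin P.n} {t : unitInterval} (ht : t ∈ P.part.openPiece i) :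
    P.branch i t = τ t :=
  extendFrom_extends (P.continuousOn i) t ht

theorem exists_tendsto (i : Fin P.n) :
    (∃ y, Tendsto τ (𝓝[>] (P.part.pt i.castSucc)) (𝓝 y)) ∧
      ∃ y, Tendsto τ (𝓝[<] (P.part.pt i.succ)) (𝓝 y) := by
  have hne : (Ioo (P.part.pt i.castSucc) (P.part.pt i.succ)).Nonempty :=
    nonempty_Ioo.2 (pt_castSucc_lt_pt_succ _ i)
  rcases P.strictMonotonic i with h | h
  · exact ⟨⟨_, h.monotoneOn.tendsto_nhdsWithin_Ioo_right hne (OrderBot.bddBelow _)⟩,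
      ⟨_, h.monotoneOn.tendsto_nhdsWithin_Ioo_left hne (OrderTop.bddAbove _)⟩⟩
  · have h' : MonotoneOn (β := unitIntervalᵒᵈ) τ (P.part.openPiece i) := h.dual_right.monotoneOn
    exact ⟨⟨_, MonotoneOn.tendsto_nhdsWithin_Ioo_right (β := unitIntervalᵒᵈ) hne h'
        (OrderBot.bddBelow _)⟩,
      ⟨_, MonotoneOn.tendsto_nhdsWithin_Ioo_left (β := unitIntervalᵒᵈ) hne h'
        (OrderTop.bddAbove _)⟩⟩

theorem tendsto_branch_right (i : Fin P.n) :
    Tendsto τ (𝓝[>] (P.part.pt i.castSucc)) (𝓝 (P.branch i (P.part.pt i.castSucc))) := by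
  obtain ⟨y, hy⟩ := (exists_tendsto (P := P) i).1
  rwa [show P.branch i (P.part.pt i.castSucc) = y from
    eq_lim_at_left_extendFrom_Ioo (pt_castSucc_lt_pt_succ _ i) hy]

theorem tendsto_branch_left (i : Fin P.n) :
    Tendsto τ (𝓝[<] (P.part.pt i.succ)) (𝓝 (P.branch i (P.part.pt i.succ))) := by
  obtain ⟨y, hy⟩ := (exists_tendsto (P := P) i).2
  rwa [show P.branch i (P.part.pt i.succ) = y from
    eq_lim_at_right_extendFrom_Ioo (pt_castSucc_lt_pt_succ _ i) hy]

theorem continuousOn_branch (i : Fin P.n) : ContinuousOn (P.branch i) (P.part.closedPiece i) :=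
  continuousOn_Icc_extendFrom_Ioo (P.continuousOn i) (tendsto_branch_right i)
    (tendsto_branch_left i)

theorem branch_mem_hat {i : Fin P.n} {t : unitInterval} (ht : t ∈ P.part.closedPiece i) :
    P.branch i t ∈ hat τ t := by
  have hlt := pt_castSucc_lt_pt_succ P.part i
  rcases eq_endpoints_or_mem_Ioo_of_mem_Icc ht with rfl | rfl | h
  · exact Or.inr ⟨nhdsGT_neBot hlt, tendsto_branch_right i⟩
  · exact Or.inl ⟨nhdsLT_neBot hlt, tendsto_branch_left i⟩
  · rw [branch_eq_of_mem h]
    exact self_mem_hat (continuousAt_of_mem_openPiece h)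

theorem strictMonoOn_branch {i : Fin P.n} (h : StrictMonoOn τ (P.part.openPiece i)) :
    StrictMonoOn (P.branch i) (P.part.closedPiece i) :=
  strictMonoOn_Icc_of_Ioo (pt_castSucc_lt_pt_succ _ i) (continuousOn_branch i)
    (h.congr fun _ ht => (branch_eq_of_mem ht).symm)

theorem strictAntiOn_branch {i : Fin P.n} (h : StrictAntiOn τ (P.part.openPiece i)) :
    StrictAntiOn (P.branch i) (P.part.closedPiece i) :=
  strictAntiOn_Icc_of_Ioo (pt_castSucc_lt_pt_succ _ i) (continuousOn_branch i)
    (h.congr fun _ ht => (branch_eq_of_mem ht).symm)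

/-- The value lies strictly between the values of the branch at the two end points. Consequently
split points inside a piece go to points that really are split. -/
theorem branch_notMem_zero_one {i : Fin P.n} {t : unitInterval}
    (ht : t ∈ P.part.openPiece i) : P.branch i t ∉ ({0, 1} : Set unitInterval) := by
  have hlt := (pt_castSucc_lt_pt_succ P.part i).le
  have hl : P.part.pt i.castSucc ∈ P.part.closedPiece i := left_mem_Icc.2 hlt
  have hr : P.part.pt i.succ ∈ P.part.closedPiece i := right_mem_Icc.2 hlt
  have ht' : t ∈ P.part.closedPiece i := Ioo_subset_Icc_self ht
  rcases P.strictMonotonic i with h | h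
  · have h' := strictMonoOn_branch h
    rintro (h0 | h1)
    · exact (unitInterval.nonneg'.trans_lt (h' hl ht' ht.1)).ne' h0
    · exact ((h' ht' hr ht.2).trans_le unitInterval.le_one').ne h1
  · have h' := strictAntiOn_branch h
    rintro (h0 | h1)
    · exact (unitInterval.nonneg'.trans_lt (h' ht' hr ht.2)).ne' h0
    · exact ((h' hl ht' ht.1).trans_le unitInterval.le_one').ne h1

theorem branch_mem_diff {i : Fin P.n} {t : unitInterval} (ht : t ∈ P.part.openPiece i)
    (htS : t ∈ P.orbitSet) : P.branch i t ∈ P.orbitSet \ {0, 1} :=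
  ⟨mem_orbitSet_of_mem_hat htS (branch_mem_hat (Ioo_subset_Icc_self ht)),
    branch_notMem_zero_one ht⟩

theorem notMem_zero_one_of_mem_openPiece {n : ℕ} {b : IntervalPartition n} {i : Fin n}
    {t : unitInterval} (ht : t ∈ b.openPiece i) : t ∉ ({0, 1} : Set unitInterval) := by
  rintro (h | h)
  · exact (unitInterval.nonneg'.trans_lt ht.1).ne' h
  · exact (ht.2.trans_le unitInterval.le_one').ne h

/-! ### The local homeomorphism on the intervals of monotonicity -/

theorem collapse_localHomeo {i : Fin P.n} {x : P.Space} (hx : x ∈ cell P.part i) :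
    (P.localHomeo x).collapse = P.branch i x.collapse := by
  rw [localHomeo, collapse_side, (cellIndex_eq_iff P.pt_mem_orbitSet).2 hx]

theorem localHomeo_of_strictMonoOn {i : Fin P.n} (h : StrictMonoOn τ (P.part.openPiece i))
    {x : P.Space} (hx : x ∈ cell P.part i) :
    P.localHomeo x = side x.tag (P.branch i x.collapse) := by
  rw [localHomeo, (cellIndex_eq_iff P.pt_mem_orbitSet).2 hx, if_pos h]

theorem localHomeo_of_strictAntiOn {i : Fin P.n} (h : StrictAntiOn τ (P.part.openPiece i))
    {x : P.Space} (hx : x ∈ cell P.part i) :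
    P.localHomeo x = side (!x.tag) (P.branch i x.collapse) := by
  rw [localHomeo, (cellIndex_eq_iff P.pt_mem_orbitSet).2 hx, if_neg]
  -- The definition of σ tests for increase first; a map cannot be both increasing and decreasing on
  -- a nonempty open interval.
  intro h'
  obtain ⟨u, hu⟩ := exists_between (pt_castSucc_lt_pt_succ P.part i)
  obtain ⟨v, hv⟩ := exists_between hu.2
  have hv' : v ∈ P.part.openPiece i := ⟨hu.1.trans hv.1, hv.2⟩
  exact not_strictAntiOn_of_monotoneOn h'.monotoneOn h hv.1 ⟨hu, hu⟩ ⟨hv', hv'⟩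

theorem collapse_localHomeo_mem_hat (x : P.Space) :
    (P.localHomeo x).collapse ∈ hat τ x.collapse := by
  have hx := mem_cell_cellIndex P.part x
  rw [collapse_localHomeo hx]
  exact branch_mem_hat (collapse_mem_closedPiece hx)

theorem collapse_localHomeo_of_notMem {x : P.Space} (hx : x.collapse ∉ P.endpoints) :
    (P.localHomeo x).collapse = τ x.collapse :=
  eq_of_mem_hat (continuousAt_of_notMem hx) (collapse_localHomeo_mem_hat x)

/-- At the unsplit point 0 this is the tag convention, so the tag formulas for σ hold at the left
end of every cell; `tag_side_false_pt` does the same for right ends, including 1. -/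
theorem tag_side_true_pt {n : ℕ} {b : IntervalPartition n} {S : Set unitInterval}
    (hb : ∀ i, b.pt i ∈ S) (i : Fin n) :
    (side true (b.pt i.castSucc) : Disconnection S).tag = true := by
  by_cases h : b.pt i.castSucc = 0
  · have := (side true (b.pt i.castSucc) : Disconnection S).mem_or_tag
    rw [collapse_side, h] at this
    rw [h]
    exact (this.resolve_left fun h' => h'.2 (Or.inl rfl)).2 rfl
  · refine tag_side _ ⟨hb _, ?_⟩
    rintro (h' | h')
    · exact h h'
    · exact ((pt_castSucc_lt_pt_succ b i).trans_le unitInterval.le_one').ne h'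

theorem tag_side_false_pt {n : ℕ} {b : IntervalPartition n} {S : Set unitInterval}
    (hb : ∀ i, b.pt i ∈ S) (i : Fin n) :
    (side false (b.pt i.succ) : Disconnection S).tag = false := by
  have h0 : b.pt i.succ ≠ 0 := (unitInterval.nonneg'.trans_lt (pt_castSucc_lt_pt_succ b i)).ne'
  by_cases h : b.pt i.succ = 1
  · have := (side false (b.pt i.succ) : Disconnection S).mem_or_tag
    rw [collapse_side] at this
    have h2 := this.resolve_left fun h' => h'.2 (Or.inr h)
    cases hs : (side false (b.pt i.succ) : Disconnection S).tag
    · rfl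
    · exact absurd (h2.1 hs) h0
  · refine tag_side _ ⟨hb _, ?_⟩
    rintro (h' | h')
    · exact h0 h'
    · exact h h'

theorem strictMonoOn_localHomeo {i : Fin P.n} (h : StrictMonoOn τ (P.part.openPiece i)) :
    StrictMonoOn P.localHomeo (cell P.part i) := by
  intro x hx y hy hxy
  rcases (collapse_mono hxy.le).lt_or_eq with hlt | heq
  · refine lt_of_collapse_lt ?_
    rw [collapse_localHomeo hx, collapse_localHomeo hy]
    exact strictMonoOn_branch h (collapse_mem_closedPiece hx) (collapse_mem_closedPiece hy) hlt
  · obtain ⟨hm, h1, h2⟩ := eq_side_of_lt hxy heq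
    have ht := mem_openPiece_of_side_mem_cell hm (h1 ▸ hx) (h2 ▸ hy)
    rw [localHomeo_of_strictMonoOn h hx, localHomeo_of_strictMonoOn h hy, ← heq,
      show x.tag = false by rw [h1, tag_side _ hm], show y.tag = true by rw [h2, tag_side _ hm]]
    exact side_false_lt_side_true (branch_mem_diff ht hm.1)

theorem strictAntiOn_localHomeo {i : Fin P.n} (h : StrictAntiOn τ (P.part.openPiece i)) :
    StrictAntiOn P.localHomeo (cell P.part i) := by
  intro x hx y hy hxy
  rcases (collapse_mono hxy.le).lt_or_eq with hlt | heq
  · refine lt_of_collapse_lt ?_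
    rw [collapse_localHomeo hx, collapse_localHomeo hy]
    exact strictAntiOn_branch h (collapse_mem_closedPiece hx) (collapse_mem_closedPiece hy) hlt
  · obtain ⟨hm, h1, h2⟩ := eq_side_of_lt hxy heq
    have ht := mem_openPiece_of_side_mem_cell hm (h1 ▸ hx) (h2 ▸ hy)
    rw [localHomeo_of_strictAntiOn h hx, localHomeo_of_strictAntiOn h hy, ← heq,
      show x.tag = false by rw [h1, tag_side _ hm], show y.tag = true by rw [h2, tag_side _ hm]]
    exact side_false_lt_side_true (branch_mem_diff ht hm.1)

/-- If t is split, the tag can be chosen to match that of z. If not, backward closure of I₁ shows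
that the image is not split either, so z is the only point over it. -/
theorem exists_localHomeo_eq_of_branch_eq {i : Fin P.n} {t : unitInterval}
    (ht : t ∈ P.part.openPiece i) {z : P.Space} (hz : P.branch i t = z.collapse) :
    ∃ s, P.localHomeo (side s t) = z := by
  have hmem : ∀ s, (side s t : P.Space) ∈ cell P.part i := fun s =>
    mem_cell_of_collapse_mem (by rwa [collapse_side])
  have hcol : ∀ s, (P.localHomeo (side s t)).collapse = z.collapse := fun s => by
    rw [collapse_localHomeo (hmem s), collapse_side, hz]
  by_cases hS : t ∈ P.orbitSet
  · have htd : t ∈ P.orbitSet \ {0, 1} := ⟨hS, notMem_zero_one_of_mem_openPiece ht⟩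
    rcases P.strictMonotonic i with h | h
    · refine ⟨z.tag, ?_⟩
      rw [localHomeo_of_strictMonoOn h (hmem _), collapse_side, hz, tag_side _ htd,
        side_tag_collapse]
    · refine ⟨!z.tag, ?_⟩
      rw [localHomeo_of_strictAntiOn h (hmem _), collapse_side, hz, tag_side _ htd, Bool.not_not,
        side_tag_collapse]
  · refine ⟨true, eq_of_collapse_notMem (hcol _) ?_⟩
    rw [hcol]
    intro hz'
    rw [← hz] at hz'
    exact hS (mem_orbitSet_of_hat_mem hz'.1 (branch_mem_hat (Ioo_subset_Icc_self ht)))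

/-- The intermediate value theorem finds t over which a preimage of z must lie. At an end point of
the piece only one copy of t is available, and the bounds on z force z to be its image. Convexity of
the image turns strict monotonicity of σ into continuity. -/
theorem ordConnected_image_localHomeo (i : Fin P.n) :
    OrdConnected (P.localHomeo '' cell P.part i) := by
  refine ⟨?_⟩
  rintro _ ⟨x, hx, rfl⟩ _ ⟨y, hy, rfl⟩ z ⟨hz1, hz2⟩
  have hx' := collapse_mem_closedPiece hx
  have hy' := collapse_mem_closedPiece hy
  have hsub : uIcc x.collapse y.collapse ⊆ P.part.closedPiece i :=
    ordConnected_Icc.uIcc_subset hx' hy'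
  have hzc : z.collapse ∈ uIcc (P.branch i x.collapse) (P.branch i y.collapse) := by
    refine Icc_subset_uIcc ⟨?_, ?_⟩
    · simpa only [collapse_localHomeo hx] using collapse_mono hz1
    · simpa only [collapse_localHomeo hy] using collapse_mono hz2
  obtain ⟨t, ht, htz⟩ := intermediate_value_uIcc ((continuousOn_branch i).mono hsub) hzc
  rcases eq_endpoints_or_mem_Ioo_of_mem_Icc (hsub ht) with rfl | rfl | ht'
  · refine ⟨_, side_true_pt_mem_cell i, ?_⟩
    rcases P.strictMonotonic i with h | h
    · have hle := ((strictMonoOn_localHomeo h).monotoneOn (side_true_pt_mem_cell i) hx hx.1).trans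
        hz1
      rw [localHomeo_of_strictMonoOn h (side_true_pt_mem_cell i),
        tag_side_true_pt P.pt_mem_orbitSet, collapse_side, htz] at hle ⊢
      exact (eq_side_true_of_ge hle rfl).symm
    · have hle := hz2.trans
        ((strictAntiOn_localHomeo h).antitoneOn (side_true_pt_mem_cell i) hy hy.1)
      rw [localHomeo_of_strictAntiOn h (side_true_pt_mem_cell i),
        tag_side_true_pt P.pt_mem_orbitSet, collapse_side, htz] at hle ⊢
      exact (eq_side_false_of_le hle rfl).symm
  · refine ⟨_, side_false_pt_mem_cell i, ?_⟩
    rcases P.strictMonotonic i with h | h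
    · have hle := hz2.trans
        ((strictMonoOn_localHomeo h).monotoneOn hy (side_false_pt_mem_cell i) hy.2)
      rw [localHomeo_of_strictMonoOn h (side_false_pt_mem_cell i),
        tag_side_false_pt P.pt_mem_orbitSet, collapse_side, htz] at hle ⊢
      exact (eq_side_false_of_le hle rfl).symm
    · have hle := ((strictAntiOn_localHomeo h).antitoneOn hx (side_false_pt_mem_cell i) hx.2).trans
        hz1
      rw [localHomeo_of_strictAntiOn h (side_false_pt_mem_cell i),
        tag_side_false_pt P.pt_mem_orbitSet, collapse_side, htz] at hle ⊢
      exact (eq_side_true_of_ge hle rfl).symm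
  · obtain ⟨s, hs⟩ := exists_localHomeo_eq_of_branch_eq ht' htz
    exact ⟨_, mem_cell_of_collapse_mem (by rwa [collapse_side]), hs⟩

theorem continuous_localHomeo : Continuous P.localHomeo := by
  rw [continuous_iff_continuousAt]
  intro x
  set i := cellIndex P.part x
  have hx : x ∈ cell P.part i := mem_cell_cellIndex P.part x
  have hopen := isOpen_cell P.pt_mem_orbitSet i
  refine ContinuousOn.continuousAt (s := cell P.part i) ?_ (hopen.mem_nhds hx)
  rw [continuousOn_iff_continuous_domRestrict]
  have hoc : OrdConnected (cell P.part i : Set P.Space) := ordConnected_Icc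
  have hr : OrdConnected (range ((cell P.part i).domRestrict P.localHomeo)) := by
    rw [range_domRestrict]
    exact ordConnected_image_localHomeo i
  rcases P.strictMonotonic i with h | h
  · exact (((strictMonoOn_localHomeo h).domRestrict).isEmbedding_of_ordConnected
      (hc := hr)).continuous
  · have hm : StrictMono (OrderDual.toDual ∘ (cell P.part i).domRestrict P.localHomeo) :=
      fun a b hab => strictAntiOn_localHomeo h a.2 b.2 hab
    have hr' : OrdConnected (range (OrderDual.toDual ∘ (cell P.part i).domRestrict P.localHomeo)) :=
      hr.dual
    exact (hm.isEmbedding_of_ordConnected (hc := hr')).continuous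

end MonotonicPartition

/-! ### Points in general position with respect to a partition -/

variable {P : MonotonicPartition τ}

theorem Disconnection.eq_of_mem_openPiece_of_mem_closedPiece {n : ℕ} {b : IntervalPartition n}
    {t : unitInterval} {i j : Fin n} (h1 : t ∈ b.openPiece i) (h2 : t ∈ b.closedPiece j) :
    i = j := by
  have h3 := b.strictMono.lt_iff_lt.1 (h1.1.trans_le h2.2)
  have h4 := b.strictMono.lt_iff_lt.1 (h2.1.trans_lt h1.2)
  rw [Fin.castSucc_lt_succ_iff] at h3 h4
  exact le_antisymm h3 h4

theorem MonotonicPartition.exists_generic_mem_Ioo (P : MonotonicPartition τ)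
    {F : Set unitInterval} (hF : F.Finite) {u v : unitInterval} (huv : u < v) :
    ∃ w ∈ Ioo u v, w ∉ P.endpoints ∧ w ∉ F ∧ τ w ∉ F := by
  obtain ⟨w, hw, hwC⟩ := ((Ioo_infinite huv).sdiff (finite_range P.part.pt)).nonempty
  obtain ⟨l, hl⟩ := exists_mem_openPiece P.part hwC
  have hinj : InjOn τ (P.part.openPiece l) :=
    (P.strictMonotonic l).elim StrictMonoOn.injOn StrictAntiOn.injOn
  have hK : (Ioo u v ∩ P.part.openPiece l).Infinite := by
    rw [IntervalPartition.openPiece, Ioo_inter_Ioo]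
    exact Ioo_infinite (max_lt_iff.2 ⟨lt_min_iff.2 ⟨huv, hw.1.trans hl.2⟩,
      lt_min_iff.2 ⟨hl.1.trans hw.2, hl.1.trans hl.2⟩⟩)
  -- Injectivity of τ on the piece lets only finitely many points be sent into F.
  have hfin : ((Ioo u v ∩ P.part.openPiece l) ∩ τ ⁻¹' F).Finite :=
    Finite.of_finite_image (hF.subset (image_subset_iff.2 inter_subset_right))
      (hinj.mono (inter_subset_left.trans inter_subset_right))
  obtain ⟨x, ⟨hx, hxF⟩, hxτ⟩ := ((hK.sdiff hF).sdiff hfin).nonempty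
  exact ⟨x, hx.1, fun ⟨k, hk⟩ => pt_notMem_openPiece k l (hk ▸ hx.2), hxF,
    fun h => hxτ ⟨hx, h⟩⟩

/-! ### Orbits landing in the Markov partition -/

namespace MarkovPartition

variable (M : MarkovPartition P)

/-- By monotonicity, a one-sided limit at an end of a Markov interval is an extreme point of the
closure of its image. That closure is a union of closed partition intervals, so its extreme points
are partition points. -/
theorem hatImage_range_subset : hatImage τ (range M.part.pt) ⊆ range M.part.pt := by
  have key : ∀ i, ∀ y ∈ closure (τ '' M.part.openPiece i),
      (y ∈ upperBounds (τ '' M.part.openPiece i) ∨ y ∈ lowerBounds (τ '' M.part.openPiece i)) →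
      y ∈ range M.part.pt := by
    intro i y hy hb
    obtain ⟨s, hs⟩ := M.closure_image i
    rw [hs] at hy
    simp only [mem_iUnion] at hy
    obtain ⟨j, hj, hyj⟩ := hy
    have hsub : M.part.closedPiece j ⊆ closure (τ '' M.part.openPiece i) :=
      hs ▸ subset_biUnion_of_mem hj
    have hle := (pt_castSucc_lt_pt_succ M.part j).le
    rcases hb with hb | hb
    · rw [← upperBounds_closure] at hb
      exact ⟨_, le_antisymm (hb (hsub (right_mem_Icc.2 hle))) hyj.2⟩
    · rw [← lowerBounds_closure] at hb
      exact ⟨_, le_antisymm hyj.1 (hb (hsub (left_mem_Icc.2 hle)))⟩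
  refine iUnion₂_subset ?_
  rintro _ ⟨k, rfl⟩ y hy
  rcases hy with ⟨hne, hy⟩ | ⟨hne, hy⟩
  · rcases Fin.eq_zero_or_eq_succ k with rfl | ⟨i, rfl⟩
    · rw [M.part.zero] at hne
      exact absurd hne (by rw [show (0 : unitInterval) = ⊥ from rfl]; simp)
    · have hlt := pt_castSucc_lt_pt_succ M.part i
      have hev : ∀ t < M.part.pt i.succ, ∀ᶠ u in 𝓝[<] (M.part.pt i.succ),
          u ∈ Ioo t (M.part.pt i.succ) := fun t ht => Ioo_mem_nhdsLT ht
      refine key i y (mem_closure_of_tendsto hy ?_) ?_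
      · filter_upwards [hev _ hlt] with u hu using mem_image_of_mem _ hu
      · rcases M.monotonic i with h | h
        · refine Or.inl ?_
          rintro _ ⟨t, ht, rfl⟩
          refine ge_of_tendsto hy ?_
          filter_upwards [hev _ ht.2] with u hu using h ht ⟨ht.1.trans hu.1, hu.2⟩ hu.1.le
        · refine Or.inr ?_
          rintro _ ⟨t, ht, rfl⟩
          refine le_of_tendsto hy ?_
          filter_upwards [hev _ ht.2] with u hu using h ht ⟨ht.1.trans hu.1, hu.2⟩ hu.1.le
  · rcases Fin.eq_castSucc_or_eq_last k with ⟨i, rfl⟩ | rfl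
    · have hlt := pt_castSucc_lt_pt_succ M.part i
      have hev : ∀ t > M.part.pt i.castSucc, ∀ᶠ u in 𝓝[>] (M.part.pt i.castSucc),
          u ∈ Ioo (M.part.pt i.castSucc) t := fun t ht => Ioo_mem_nhdsGT ht
      refine key i y (mem_closure_of_tendsto hy ?_) ?_
      · filter_upwards [hev _ hlt] with u hu using mem_image_of_mem _ hu
      · rcases M.monotonic i with h | h
        · refine Or.inr ?_
          rintro _ ⟨t, ht, rfl⟩
          refine le_of_tendsto hy ?_
          filter_upwards [hev _ ht.1] with u hu using h ⟨hu.1, hu.2.trans ht.2⟩ ht hu.2.le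
        · refine Or.inl ?_
          rintro _ ⟨t, ht, rfl⟩
          refine ge_of_tendsto hy ?_
          filter_upwards [hev _ ht.1] with u hu using h ⟨hu.1, hu.2.trans ht.2⟩ ht hu.2.le
    · rw [M.part.last] at hne
      exact absurd hne (by rw [show (1 : unitInterval) = ⊤ from rfl]; simp)

theorem iterate_hatImage_mono (k : ℕ) : Monotone ((hatImage τ)^[k]) :=
  Monotone.iterate (fun _ _ => hatImage_mono) k

/-- Every point of the generalized orbit is eventually mapped into the Markov partition. -/
theorem exists_forall_iterate_hatImage_subset {x : unitInterval} (hx : x ∈ P.orbitSet) :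
    ∃ k, ∀ n ≥ k, (hatImage τ)^[n] {x} ⊆ range M.part.pt := by
  -- By minimality of I₁ it suffices that the points with this property contain C and are closed
  -- under τ̂ and τ̂⁻¹.
  have hmain : x ∈ {x | ∃ k, (hatImage τ)^[k] {x} ⊆ range M.part.pt} := by
    refine generalizedOrbit_subset ?_ ?_ ?_ hx
    · intro c hc
      obtain ⟨k, hk⟩ := M.eventually_mem
      exact ⟨k, (iterate_hatImage_mono k (singleton_subset_iff.2 hc)).trans hk⟩
    · refine iUnion₂_subset ?_
      rintro x ⟨k, hk⟩ y hy
      refine ⟨k, (iterate_hatImage_mono k (singleton_subset_iff.2 hy)).trans ?_⟩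
      rw [← hatImage_singleton, ← Function.iterate_succ_apply, Function.iterate_succ_apply']
      exact (hatImage_mono hk).trans M.hatImage_range_subset
    · rintro x ⟨y, hy, k, hk⟩
      -- Off C the map is continuous, so τ̂(x) is a single point and the property pulls back; points
      -- of C have it by the Markov hypothesis.
      by_cases hC : x ∈ P.endpoints
      · obtain ⟨k, hk⟩ := M.eventually_mem
        exact ⟨k, (iterate_hatImage_mono k (singleton_subset_iff.2 hC)).trans hk⟩
      · have hc := MonotonicPartition.continuousAt_of_notMem hC
        refine ⟨k + 1, ?_⟩
        rw [Function.iterate_succ_apply, hatImage_singleton]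
        refine (iterate_hatImage_mono k fun z hz => ?_).trans hk
        rw [mem_singleton_iff, eq_of_mem_hat hc hz, eq_of_mem_hat hc hy]
  obtain ⟨k, hk⟩ := hmain
  refine ⟨k, fun n hn => ?_⟩
  induction n, hn using Nat.le_induction with
  | base => exact hk
  | succ n _ ih =>
    rw [Function.iterate_succ_apply']
    exact (hatImage_mono ih).trans M.hatImage_range_subset

theorem collapse_iterate_localHomeo_mem (x : P.Space) (k : ℕ) :
    (P.localHomeo^[k] x).collapse ∈ (hatImage τ)^[k] {x.collapse} := by
  induction k with
  | zero => exact rfl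
  | succ k ih =>
    rw [Function.iterate_succ_apply', Function.iterate_succ_apply']
    exact mem_biUnion ih (MonotonicPartition.collapse_localHomeo_mem_hat _)

/-! ### Strict monotonicity on the Markov cells -/

theorem pt_mem_openPiece_of_mem_cell {i : Fin M.m} {l l' : Fin P.n} (hll : l < l')
    {x y : P.Space} (hx : x ∈ M.cell i) (hy : y ∈ M.cell i) (hxl : x ∈ Disconnection.cell P.part l)
    (hyl : y ∈ Disconnection.cell P.part l') :
    P.part.pt l.succ ∈ M.part.openPiece i ∧ P.part.pt l'.castSucc ∈ M.part.openPiece i := by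
  have hcd : P.part.pt l.succ ≤ P.part.pt l'.castSucc :=
    P.part.strictMono.monotone (Fin.succ_le_castSucc_iff.2 hll)
  have hc0 := unitInterval.nonneg'.trans_lt (pt_castSucc_lt_pt_succ P.part l)
  have hd1 := (pt_castSucc_lt_pt_succ P.part l').trans_le unitInterval.le_one'
  have hc : P.part.pt l.succ ∈ P.orbitSet \ {0, 1} :=
    ⟨P.pt_mem_orbitSet _, by
      rintro (h | h)
      · exact hc0.ne' h
      · exact (hcd.trans_lt hd1).ne h⟩
  have hd : P.part.pt l'.castSucc ∈ P.orbitSet \ {0, 1} :=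
    ⟨P.pt_mem_orbitSet _, by
      rintro (h | h)
      · exact (hc0.trans_le hcd).ne' h
      · exact hd1.ne h⟩
  have h1 : M.part.pt i.castSucc < P.part.pt l.succ := by
    have hle := hx.1.trans hxl.2
    refine lt_of_le_of_ne (by simpa only [collapse_side] using collapse_mono hle) fun h => ?_
    rw [h] at hle
    exact hle.not_gt (side_false_lt_side_true hc)
  have h2 : P.part.pt l'.castSucc < M.part.pt i.succ := by
    have hle := hyl.1.trans hy.2
    refine lt_of_le_of_ne (by simpa only [collapse_side] using collapse_mono hle) fun h => ?_
    rw [← h] at hle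
    exact hle.not_gt (side_false_lt_side_true hd)
  exact ⟨⟨h1, hcd.trans_lt h2⟩, ⟨h1.trans_le hcd, h2⟩⟩

theorem exists_lt_of_nonempty_inter {a a' b b' t : unitInterval} (h : t ∈ Ioo a a' ∩ Ioo b b') :
    ∃ u v, u < v ∧ u ∈ Ioo a a' ∩ Ioo b b' ∧ v ∈ Ioo a a' ∩ Ioo b b' := by
  obtain ⟨v, hv⟩ := exists_between (lt_min h.1.2 h.2.2)
  rw [lt_min_iff] at hv
  exact ⟨t, v, hv.1, h, ⟨h.1.1.trans hv.1, hv.2.1⟩, ⟨h.2.1.trans hv.1, hv.2.2⟩⟩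

theorem inter_openPiece_nonempty {i : Fin M.m} {l : Fin P.n} {x y : P.Space} (hxy : x < y)
    (hx : x ∈ M.cell i) (hy : y ∈ M.cell i) (hxl : x ∈ Disconnection.cell P.part l) (hyl : y ∈ Disconnection.cell P.part l) :
    (M.part.openPiece i ∩ P.part.openPiece l).Nonempty := by
  rcases (collapse_mono hxy.le).lt_or_eq with hlt | heq
  · obtain ⟨t, ht⟩ := exists_between hlt
    exact ⟨t, ⟨(collapse_mem_closedPiece hx).1.trans_lt ht.1,
        ht.2.trans_le (collapse_mem_closedPiece hy).2⟩,
      ⟨(collapse_mem_closedPiece hxl).1.trans_lt ht.1,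
        ht.2.trans_le (collapse_mem_closedPiece hyl).2⟩⟩
  · obtain ⟨hm, h1, h2⟩ := eq_side_of_lt hxy heq
    rw [h1] at hx hxl
    rw [h2] at hy hyl
    exact ⟨_, mem_openPiece_of_side_mem_cell hm hx hy, mem_openPiece_of_side_mem_cell hm hxl hyl⟩

theorem inter_openPiece_nonempty_of_pt_succ_mem {i : Fin M.m} {l : Fin P.n}
    (h : P.part.pt l.succ ∈ M.part.openPiece i) :
    (M.part.openPiece i ∩ P.part.openPiece l).Nonempty := by
  obtain ⟨t, ht⟩ := exists_between (max_lt h.1 (pt_castSucc_lt_pt_succ P.part l))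
  rw [max_lt_iff] at ht
  exact ⟨t, ⟨ht.1.1, ht.2.trans h.2⟩, ⟨ht.1.2, ht.2⟩⟩

theorem inter_openPiece_nonempty_of_pt_castSucc_mem {i : Fin M.m} {l : Fin P.n}
    (h : P.part.pt l.castSucc ∈ M.part.openPiece i) :
    (M.part.openPiece i ∩ P.part.openPiece l).Nonempty := by
  obtain ⟨t, ht⟩ := exists_between (lt_min h.2 (pt_castSucc_lt_pt_succ P.part l))
  rw [lt_min_iff] at ht
  exact ⟨t, ⟨h.1.trans ht.1, ht.2.1⟩, ⟨ht.1, ht.2.2⟩⟩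

/-- On the overlap, a nonempty open interval, the direction of the Markov interval decides that of
the piece. -/
theorem strictMonoOn_of_monotoneOn {i : Fin M.m} (h : MonotoneOn τ (M.part.openPiece i))
    {l : Fin P.n} (hne : (M.part.openPiece i ∩ P.part.openPiece l).Nonempty) :
    StrictMonoOn τ (P.part.openPiece l) := by
  refine (P.strictMonotonic l).resolve_right fun h' => ?_
  obtain ⟨t, ht⟩ := hne
  obtain ⟨u, v, huv, hu, hv⟩ := exists_lt_of_nonempty_inter ht
  exact not_strictAntiOn_of_monotoneOn h h' huv hu hv

theorem strictAntiOn_of_antitoneOn {i : Fin M.m} (h : AntitoneOn τ (M.part.openPiece i))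
    {l : Fin P.n} (hne : (M.part.openPiece i ∩ P.part.openPiece l).Nonempty) :
    StrictAntiOn τ (P.part.openPiece l) := by
  refine (P.strictMonotonic l).resolve_left fun h' => ?_
  obtain ⟨t, ht⟩ := hne
  obtain ⟨u, v, huv, hu, hv⟩ := exists_lt_of_nonempty_inter ht
  exact not_strictAntiOn_of_monotoneOn h.dual_right h'.dual_right huv hu hv

theorem lt_of_cellIndex_ne {l l' : Fin P.n} {x y : P.Space} (hxy : x < y)
    (hxl : x ∈ Disconnection.cell P.part l) (hyl : y ∈ Disconnection.cell P.part l')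
    (hne : l ≠ l') : l < l' := by
  refine lt_of_le_of_ne (not_lt.1 fun h => ?_) hne
  exact hxy.not_gt (lt_of_mem_cell P.pt_mem_orbitSet h hyl hxl)

/-- A Markov interval may contain points of C, where τ can jump. If x and y lie in different pieces,
they are compared through c⁻ and d⁺, where c ends the piece of x and d starts that of y. -/
theorem strictMonoOn_localHomeo_cell {i : Fin M.m} (h : MonotoneOn τ (M.part.openPiece i)) :
    StrictMonoOn P.localHomeo (M.cell i) := by
  intro x hx y hy hxy
  obtain ⟨l, hxl⟩ := exists_mem_cell P.part x
  obtain ⟨l', hyl⟩ := exists_mem_cell P.part y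
  by_cases hll : l = l'
  · subst hll
    exact MonotonicPartition.strictMonoOn_localHomeo
      (M.strictMonoOn_of_monotoneOn h (M.inter_openPiece_nonempty hxy hx hy hxl hyl)) hxl hyl hxy
  · obtain ⟨hc, hd⟩ :=
      M.pt_mem_openPiece_of_mem_cell (lt_of_cellIndex_ne hxy hxl hyl hll) hx hy hxl hyl
    have hl := M.strictMonoOn_of_monotoneOn h (M.inter_openPiece_nonempty_of_pt_succ_mem hc)
    have hl' := M.strictMonoOn_of_monotoneOn h (M.inter_openPiece_nonempty_of_pt_castSucc_mem hd)
    have hle := (pt_castSucc_lt_pt_succ P.part l)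
    have hle' := (pt_castSucc_lt_pt_succ P.part l')
    have hcd : P.part.pt l.succ ≤ P.part.pt l'.castSucc :=
      P.part.strictMono.monotone (Fin.succ_le_castSucc_iff.2 (lt_of_cellIndex_ne hxy hxl hyl hll))
    have : (𝓝[<] (P.part.pt l.succ)).NeBot := nhdsLT_neBot hle
    have : (𝓝[>] (P.part.pt l'.castSucc)).NeBot := nhdsGT_neBot hle'
    have hlim : P.branch l (P.part.pt l.succ) ≤ P.branch l' (P.part.pt l'.castSucc) := by
      refine le_of_tendsto (MonotonicPartition.tendsto_branch_left l) ?_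
      filter_upwards [Ioo_mem_nhdsLT hc.1] with u hu
      refine ge_of_tendsto (MonotonicPartition.tendsto_branch_right l') ?_
      filter_upwards [Ioo_mem_nhdsGT hd.2] with v hv
      exact h ⟨hu.1, hu.2.trans hc.2⟩ ⟨hd.1.trans hv.1, hv.2⟩
        (hu.2.le.trans (hcd.trans hv.1.le))
    have h1 := (MonotonicPartition.strictMonoOn_localHomeo hl).monotoneOn hxl
      (side_false_pt_mem_cell l) hxl.2
    have h2 := (MonotonicPartition.strictMonoOn_localHomeo hl').monotoneOn
      (side_true_pt_mem_cell l') hyl hyl.1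
    refine h1.trans_lt (lt_of_lt_of_le ?_ h2)
    rw [MonotonicPartition.localHomeo_of_strictMonoOn hl (side_false_pt_mem_cell l),
      MonotonicPartition.localHomeo_of_strictMonoOn hl' (side_true_pt_mem_cell l'),
      MonotonicPartition.tag_side_false_pt P.pt_mem_orbitSet,
      MonotonicPartition.tag_side_true_pt P.pt_mem_orbitSet, collapse_side, collapse_side]
    rcases hlim.lt_or_eq with hlt | heq
    · exact lt_of_collapse_lt (by rwa [collapse_side, collapse_side])
    -- Equal one-sided limits: the common value is in I₁ and, by strict monotonicity of both
    -- branches, is neither 0 nor 1. It is therefore split, and its two copies keep the inequality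
    -- strict.
    · rw [← heq]
      refine side_false_lt_side_true ⟨MonotonicPartition.mem_orbitSet_of_mem_hat
        (P.pt_mem_orbitSet _) (MonotonicPartition.branch_mem_hat (right_mem_Icc.2 hle.le)), ?_⟩
      rintro (h0 | h0)
      · exact (unitInterval.nonneg'.trans_lt (MonotonicPartition.strictMonoOn_branch hl
          (left_mem_Icc.2 hle.le) (right_mem_Icc.2 hle.le) hle)).ne' h0
      · rw [heq] at h0
        exact ((MonotonicPartition.strictMonoOn_branch hl'
          (left_mem_Icc.2 hle'.le) (right_mem_Icc.2 hle'.le) hle').trans_le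
            unitInterval.le_one').ne h0

theorem strictAntiOn_localHomeo_cell {i : Fin M.m} (h : AntitoneOn τ (M.part.openPiece i)) :
    StrictAntiOn P.localHomeo (M.cell i) := by
  intro x hx y hy hxy
  obtain ⟨l, hxl⟩ := exists_mem_cell P.part x
  obtain ⟨l', hyl⟩ := exists_mem_cell P.part y
  by_cases hll : l = l'
  · subst hll
    exact MonotonicPartition.strictAntiOn_localHomeo
      (M.strictAntiOn_of_antitoneOn h (M.inter_openPiece_nonempty hxy hx hy hxl hyl)) hxl hyl hxy
  · obtain ⟨hc, hd⟩ :=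
      M.pt_mem_openPiece_of_mem_cell (lt_of_cellIndex_ne hxy hxl hyl hll) hx hy hxl hyl
    have hl := M.strictAntiOn_of_antitoneOn h (M.inter_openPiece_nonempty_of_pt_succ_mem hc)
    have hl' := M.strictAntiOn_of_antitoneOn h (M.inter_openPiece_nonempty_of_pt_castSucc_mem hd)
    have hle := (pt_castSucc_lt_pt_succ P.part l)
    have hle' := (pt_castSucc_lt_pt_succ P.part l')
    have hcd : P.part.pt l.succ ≤ P.part.pt l'.castSucc :=
      P.part.strictMono.monotone (Fin.succ_le_castSucc_iff.2 (lt_of_cellIndex_ne hxy hxl hyl hll))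
    have : (𝓝[<] (P.part.pt l.succ)).NeBot := nhdsLT_neBot hle
    have : (𝓝[>] (P.part.pt l'.castSucc)).NeBot := nhdsGT_neBot hle'
    have hlim : P.branch l' (P.part.pt l'.castSucc) ≤ P.branch l (P.part.pt l.succ) := by
      refine ge_of_tendsto (MonotonicPartition.tendsto_branch_left l) ?_
      filter_upwards [Ioo_mem_nhdsLT hc.1] with u hu
      refine le_of_tendsto (MonotonicPartition.tendsto_branch_right l') ?_
      filter_upwards [Ioo_mem_nhdsGT hd.2] with v hv
      exact h ⟨hu.1, hu.2.trans hc.2⟩ ⟨hd.1.trans hv.1, hv.2⟩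
        (hu.2.le.trans (hcd.trans hv.1.le))
    have h1 := (MonotonicPartition.strictAntiOn_localHomeo hl).antitoneOn hxl
      (side_false_pt_mem_cell l) hxl.2
    have h2 := (MonotonicPartition.strictAntiOn_localHomeo hl').antitoneOn
      (side_true_pt_mem_cell l') hyl hyl.1
    refine h2.trans_lt (lt_of_lt_of_le ?_ h1)
    rw [MonotonicPartition.localHomeo_of_strictAntiOn hl (side_false_pt_mem_cell l),
      MonotonicPartition.localHomeo_of_strictAntiOn hl' (side_true_pt_mem_cell l'),
      MonotonicPartition.tag_side_false_pt P.pt_mem_orbitSet,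
      MonotonicPartition.tag_side_true_pt P.pt_mem_orbitSet, collapse_side, collapse_side]
    rcases hlim.lt_or_eq with hlt | heq
    · exact lt_of_collapse_lt (by rwa [collapse_side, collapse_side])
    · rw [heq]
      refine side_false_lt_side_true ⟨MonotonicPartition.mem_orbitSet_of_mem_hat
        (P.pt_mem_orbitSet _) (MonotonicPartition.branch_mem_hat (right_mem_Icc.2 hle.le)), ?_⟩
      rintro (h0 | h0)
      · rw [← heq] at h0
        exact (unitInterval.nonneg'.trans_lt (MonotonicPartition.strictAntiOn_branch hl'
          (left_mem_Icc.2 hle'.le) (right_mem_Icc.2 hle'.le) hle')).ne' h0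
      · exact ((MonotonicPartition.strictAntiOn_branch hl
          (left_mem_Icc.2 hle.le) (right_mem_Icc.2 hle.le) hle).trans_le
            unitInterval.le_one').ne h0

theorem strictMonoOn_or_strictAntiOn_cell (i : Fin M.m) :
    StrictMonoOn P.localHomeo (M.cell i) ∨ StrictAntiOn P.localHomeo (M.cell i) :=
  (M.monotonic i).imp M.strictMonoOn_localHomeo_cell M.strictAntiOn_localHomeo_cell

/-! ### The Markov property -/

/-- The image of a Markov cell contains every Markov cell that it meets. -/
theorem cell_subset_image {i j : Fin M.m} {x : P.Space} (hx : x ∈ M.cell i)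
    (hxj : P.localHomeo x ∈ M.cell j) : M.cell j ⊆ P.localHomeo '' M.cell i := by
  have hcl : IsClosed (P.localHomeo '' M.cell i) :=
    ((isClosed_Icc.isCompact (s := M.cell i)).image
      MonotonicPartition.continuous_localHomeo).isClosed
  have hopen : ∀ j, IsOpen (M.cell j) := fun j => isOpen_cell M.mem_orbitSet j
  obtain ⟨s, hs⟩ := M.closure_image i
  -- A generic w over a neighbourhood of x has τ w in the interior of the j-th interval, so the
  -- closed interval of the union containing τ w must be the j-th.
  have hjs : j ∈ s := by
    obtain ⟨u, v, huv, hsub⟩ := exists_preimage_Ioo_subset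
      (((hopen j).preimage MonotonicPartition.continuous_localHomeo).inter (hopen i)) ⟨x, hxj, hx⟩
    obtain ⟨w, hw, hwC, hwB, hτB⟩ := P.exists_generic_mem_Ioo (finite_range M.part.pt) huv
    have hmem : (side true w : P.Space) ∈ P.localHomeo ⁻¹' M.cell j ∩ M.cell i :=
      hsub (by rwa [mem_preimage, collapse_side])
    have h1 := collapse_mem_closedPiece hmem.1
    have h2 := collapse_mem_closedPiece hmem.2
    rw [MonotonicPartition.collapse_localHomeo_of_notMem (by rwa [collapse_side]),
      collapse_side] at h1
    rw [collapse_side] at h2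
    have h3 : τ w ∈ M.part.openPiece j :=
      ⟨lt_of_le_of_ne h1.1 fun h => hτB ⟨_, h⟩, lt_of_le_of_ne h1.2 fun h => hτB ⟨_, h.symm⟩⟩
    have h4 : w ∈ M.part.openPiece i :=
      ⟨lt_of_le_of_ne h2.1 fun h => hwB ⟨_, h⟩, lt_of_le_of_ne h2.2 fun h => hwB ⟨_, h.symm⟩⟩
    have h5 : τ w ∈ closure (τ '' M.part.openPiece i) := subset_closure (mem_image_of_mem _ h4)
    rw [hs] at h5
    simp only [mem_iUnion] at h5
    obtain ⟨j', hj', h6⟩ := h5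
    rwa [eq_of_mem_openPiece_of_mem_closedPiece h3 h6]
  by_contra hnot
  obtain ⟨z, hzj, hz⟩ := not_subset.1 hnot
  obtain ⟨u, v, huv, hsub⟩ := exists_preimage_Ioo_subset
    ((hopen j).inter hcl.isOpen_compl) ⟨z, hzj, hz⟩
  -- The part of the cell missed by the image is open, yet images of the Markov interval accumulate
  -- in it. Avoiding the finite set τ(C) ensures that w is outside C, where σ covers τ.
  have hfin : (τ '' P.endpoints).Finite := (finite_range P.part.pt).image τ
  obtain ⟨y, hy, hyC⟩ := ((Ioo_infinite huv).sdiff hfin).nonempty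
  have hyj : y ∈ M.part.closedPiece j := by
    have := collapse_mem_closedPiece (hsub (a := side true y) (by
      rwa [mem_preimage, collapse_side])).1
    rwa [collapse_side] at this
  have hycl : y ∈ closure (τ '' M.part.openPiece i) := hs ▸ mem_biUnion hjs hyj
  obtain ⟨_, ⟨hw1, hw2⟩, w, hw, rfl⟩ :=
    mem_closure_iff.1 hycl _ (isOpen_Ioo.inter hfin.isClosed.isOpen_compl) ⟨hy, hyC⟩
  have hwC : w ∉ P.endpoints := fun h => hw2 (mem_image_of_mem _ h)
  refine (hsub (a := P.localHomeo (side true w)) ?_).2 (mem_image_of_mem _ ?_)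
  · rwa [mem_preimage, MonotonicPartition.collapse_localHomeo_of_notMem (by rwa [collapse_side]),
      collapse_side]
  · exact mem_cell_of_collapse_mem (by rwa [collapse_side])

theorem mem_cell_itinerary (x : P.Space) (k : ℕ) :
    P.localHomeo^[k] x ∈ M.cell (M.itinerary x k) :=
  mem_cell_cellIndex _ _

/-- A point strictly between the images would lie in the cell j, hence in the image of the cell i,
and its preimage would separate x from y. -/
theorem covBy_localHomeo {i j : Fin M.m} {x y : P.Space} (h : x ⋖ y) (hx : x ∈ M.cell i)
    (hy : y ∈ M.cell i) (hxj : P.localHomeo x ∈ M.cell j) (hyj : P.localHomeo y ∈ M.cell j) :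
    P.localHomeo x ⋖ P.localHomeo y ∨ P.localHomeo y ⋖ P.localHomeo x := by
  have hsub := M.cell_subset_image hx hxj
  rcases M.strictMonoOn_or_strictAntiOn_cell i with hm | hm
  · refine Or.inl ⟨hm hx hy h.1, fun z h1 h2 => ?_⟩
    obtain ⟨w, hw, rfl⟩ := hsub ⟨hxj.1.trans h1.le, h2.le.trans hyj.2⟩
    exact h.2 ((hm.lt_iff_lt hx hw).1 h1) ((hm.lt_iff_lt hw hy).1 h2)
  · refine Or.inr ⟨hm hx hy h.1, fun z h1 h2 => ?_⟩
    obtain ⟨w, hw, rfl⟩ := hsub ⟨hyj.1.trans h1.le, h2.le.trans hxj.2⟩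
    exact h.2 ((hm.lt_iff_gt hw hx).1 h2) ((hm.lt_iff_gt hy hw).1 h1)

/-! ### Itineraries -/

/-- Itineraries separate the two points over a split point. -/
theorem itinerary_side_ne {t : unitInterval} (ht : t ∈ P.orbitSet \ {0, 1}) :
    M.itinerary (side false t) ≠ M.itinerary (side true t) := by
  intro heq
  set x : P.Space := side false t
  set y : P.Space := side true t
  have hmem : ∀ k, P.localHomeo^[k] y ∈ M.cell (M.itinerary x k) := fun k =>
    heq ▸ M.mem_cell_itinerary y k
  have hcov : ∀ k, P.localHomeo^[k] x ⋖ P.localHomeo^[k] y ∨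
      P.localHomeo^[k] y ⋖ P.localHomeo^[k] x := by
    intro k
    induction k with
    | zero => exact Or.inl (side_false_covBy_side_true ht)
    | succ k ih =>
      have h1 := M.mem_cell_itinerary x (k + 1)
      have h2 := hmem (k + 1)
      simp only [Function.iterate_succ_apply'] at h1 h2 ⊢
      rcases ih with ih | ih
      · exact M.covBy_localHomeo ih (M.mem_cell_itinerary x k) (hmem k) h1 h2
      · exact (M.covBy_localHomeo ih (hmem k) (M.mem_cell_itinerary x k) h2 h1).symm
  obtain ⟨k, hk⟩ := M.exists_forall_iterate_hatImage_subset ht.1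
  -- At time k the adjacent pair consists of the two copies of a Markov partition point, which
  -- cannot share a cell.
  have key : ∀ p q : P.Space, p ⋖ q → p.collapse ∈ range M.part.pt →
      p ∈ M.cell (M.itinerary x k) → q ∈ M.cell (M.itinerary x k) → False := by
    intro p q hpq hB hp hq
    obtain ⟨hm, h1, h2⟩ := eq_side_of_lt hpq.1 (collapse_eq_of_covBy hpq)
    rw [h1] at hp
    rw [h2] at hq
    obtain ⟨j, hj⟩ := hB
    have := mem_openPiece_of_side_mem_cell hm hp hq
    rw [← hj] at this
    exact pt_notMem_openPiece _ _ this
  have hc : ∀ s, (P.localHomeo^[k] (side s t)).collapse ∈ range M.part.pt := by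
    intro s
    have := collapse_iterate_localHomeo_mem (side s t : P.Space) k
    rw [collapse_side] at this
    exact hk k le_rfl this
  rcases hcov k with h | h
  · exact key _ _ h (hc false) (M.mem_cell_itinerary x k) (hmem k)
  · exact key _ _ h (hc true) (hmem k) (M.mem_cell_itinerary x k)

/-- As long as the images of x and y share a cell, σ is monotonic between them and keeps the image
of z between theirs. -/
theorem itinerary_eq_of_mem_Icc {x y z : P.Space} (h : M.itinerary x = M.itinerary y)
    (hz : z ∈ Icc x y) : M.itinerary z = M.itinerary x := by
  have hsub : ∀ k, uIcc (P.localHomeo^[k] x) (P.localHomeo^[k] y) ⊆ M.cell (M.itinerary x k) :=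
    fun k => ordConnected_Icc.uIcc_subset (M.mem_cell_itinerary x k) (h ▸ M.mem_cell_itinerary y k)
  have hmem : ∀ k, P.localHomeo^[k] z ∈ uIcc (P.localHomeo^[k] x) (P.localHomeo^[k] y) := by
    intro k
    induction k with
    | zero => exact Icc_subset_uIcc hz
    | succ k ih =>
      simp only [Function.iterate_succ_apply']
      rcases M.strictMonoOn_or_strictAntiOn_cell (M.itinerary x k) with hm | hm
      · exact (hm.monotoneOn.mono (hsub k)).mapsTo_uIcc ih
      · exact (hm.antitoneOn.mono (hsub k)).mapsTo_uIcc ih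
  funext k
  exact (cellIndex_eq_iff M.mem_orbitSet).2 (hsub k (hmem k))

theorem itinerary_injective_of_dense (hd : Dense P.orbitSet) :
    Function.Injective M.itinerary := by
  have key : ∀ x y : P.Space, x < y → M.itinerary x ≠ M.itinerary y := by
    intro x y hxy h
    obtain ⟨t, ht, h1, h2⟩ : ∃ t ∈ P.orbitSet \ {0, 1}, x ≤ side false t ∧ side true t ≤ y := by
      rcases (collapse_mono hxy.le).lt_or_eq with hlt | heq
      · obtain ⟨t, htS, ht⟩ := hd.exists_between hlt
        refine ⟨t, ⟨htS, ?_⟩, (lt_of_collapse_lt ?_).le, (lt_of_collapse_lt ?_).le⟩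
        · rintro (h | h)
          · exact (unitInterval.nonneg'.trans_lt ht.1).ne' h
          · exact (ht.2.trans_le unitInterval.le_one').ne h
        · rw [collapse_side]; exact ht.1
        · rw [collapse_side]; exact ht.2
      · obtain ⟨hm, h1, h2⟩ := eq_side_of_lt hxy heq
        exact ⟨_, hm, h1.le, h2.ge⟩
    have hle := side_false_le_side_true (S := P.orbitSet) t
    refine M.itinerary_side_ne ht ?_
    rw [M.itinerary_eq_of_mem_Icc h ⟨h1, hle.trans h2⟩,
      M.itinerary_eq_of_mem_Icc h ⟨h1.trans hle, h2⟩]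
  intro x y h
  by_contra hne
  rcases lt_or_gt_of_ne hne with hlt | hlt
  · exact key x y hlt h
  · exact key y x hlt h.symm

/-! ### Symbolic coding by itineraries -/

theorem incidence_eq_one_iff {i j : Fin M.m} :
    M.incidence i j = 1 ↔ M.cell j ⊆ P.localHomeo '' M.cell i := by
  simp [incidence]

theorem continuous_itinerary : Continuous M.itinerary :=
  continuous_pi fun k => (continuous_cellIndex M.mem_orbitSet).comp
    (MonotonicPartition.continuous_localHomeo.iterate k)

theorem itinerary_localHomeo (x : P.Space) (k : ℕ) :
    M.itinerary (P.localHomeo x) k = M.itinerary x (k + 1) := by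
  simp only [itinerary, Function.iterate_succ_apply]

theorem incidence_itinerary (x : P.Space) (k : ℕ) :
    M.incidence (M.itinerary x k) (M.itinerary x (k + 1)) = 1 := by
  rw [incidence_eq_one_iff]
  refine M.cell_subset_image (M.mem_cell_itinerary x k) ?_
  rw [← Function.iterate_succ_apply' P.localHomeo]
  exact M.mem_cell_itinerary x (k + 1)

/-- A point realizing the shifted word is pulled back along the first transition, whose cell image
contains the next cell. Compactness then passes to infinite words in `exists_itinerary_eq`. -/
theorem exists_iterate_mem_cell (n : ℕ) (s : ShiftSpace M.incidence) :
    ∃ x : P.Space, ∀ k ≤ n, P.localHomeo^[k] x ∈ M.cell (s.1 k) := by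
  induction n generalizing s with
  | zero =>
    refine ⟨side true (M.part.pt (s.1 0).castSucc), fun k hk => ?_⟩
    rw [Nat.le_zero.1 hk]
    exact side_true_pt_mem_cell _
  | succ n ih =>
    obtain ⟨y, hy⟩ := ih (shift _ s)
    obtain ⟨x, hx, hxy⟩ := M.incidence_eq_one_iff.1 (s.2 0) (hy 0 (Nat.zero_le _))
    refine ⟨x, fun k hk => ?_⟩
    rcases k with _ | k
    · exact hx
    · rw [Function.iterate_succ_apply, hxy]
      exact hy k (Nat.le_of_succ_le_succ hk)

theorem exists_itinerary_eq (s : ShiftSpace M.incidence) : ∃ x, M.itinerary x = s.1 := by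
  have hcl : ∀ n, IsClosed {x : P.Space | ∀ k ≤ n, P.localHomeo^[k] x ∈ M.cell (s.1 k)} := by
    intro n
    simp only [ofPred_forall]
    exact isClosed_biInter fun k _ =>
      isClosed_Icc.preimage (MonotonicPartition.continuous_localHomeo.iterate k)
  obtain ⟨x, hx⟩ := IsCompact.nonempty_iInter_of_sequence_nonempty_isCompact_isClosed
    (fun n => {x : P.Space | ∀ k ≤ n, P.localHomeo^[k] x ∈ M.cell (s.1 k)})
    (fun n x hx => fun k hk => hx k (Nat.le_succ_of_le hk)) (fun n => M.exists_iterate_mem_cell n s)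
    (hcl 0).isCompact hcl
  rw [mem_iInter] at hx
  exact ⟨x, funext fun k => (cellIndex_eq_iff M.mem_orbitSet).2 (hx k k le_rfl)⟩

theorem isConjugate_of_injective (h : Function.Injective M.itinerary) :
    IsConjugate P.localHomeo (shift M.incidence) := by
  let f : P.Space → ShiftSpace M.incidence := fun x => ⟨M.itinerary x, M.incidence_itinerary x⟩
  have hf : Continuous f := M.continuous_itinerary.subtype_mk _
  have hbij : Function.Bijective f :=
    ⟨fun x y hxy => h (congrArg Subtype.val hxy),
      fun s => (M.exists_itinerary_eq s).imp fun x hx => Subtype.ext hx⟩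
  exact ⟨hf.homeoOfEquivCompactToT2 (f := Equiv.ofBijective f hbij),
    fun x => Subtype.ext (funext fun k => M.itinerary_localHomeo x k)⟩

/-- Only the homeomorphism matters: X_A is totally disconnected. -/
theorem dense_of_isConjugate (h : IsConjugate P.localHomeo (shift M.incidence)) :
    Dense P.orbitSet := by
  obtain ⟨h, -⟩ := h
  have : TotallyDisconnectedSpace P.Space :=
    h.symm.totallyDisconnectedSpace
  exact dense_of_totallyDisconnectedSpace

end MarkovPartition

/-! ### Homtervals -/

/-- A continuous injective map is strictly monotonic near x, and the intermediate value theorem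
makes it open there. -/
theorem nhds_le_map_of_injOn_Ioo {f : unitInterval → unitInterval} {u v x : unitInterval}
    (hc : ContinuousOn f (Ioo u v)) (hi : InjOn f (Ioo u v)) (hx : x ∈ Ioo u v) :
    𝓝 (f x) ≤ map f (𝓝 x) := by
  intro s hs
  obtain ⟨a, b, hab, hsub⟩ := (mem_nhds_iff_exists_Ioo_subset' ⟨u, hx.1⟩ ⟨v, hx.2⟩).1
    (inter_mem hs (isOpen_Ioo.mem_nhds hx))
  obtain ⟨c, hc1, hc2⟩ := exists_between hab.1
  obtain ⟨d, hd1, hd2⟩ := exists_between hab.2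
  have hcd : Icc c d ⊆ f ⁻¹' s ∩ Ioo u v := (Icc_subset_Ioo hc1 hd2).trans hsub
  have hle := (hc2.trans hd1).le
  have hcont : ContinuousOn f (Icc c d) := hc.mono (hcd.trans inter_subset_right)
  have himage : f '' Icc c d ⊆ s := image_subset_iff.2 (hcd.trans inter_subset_left)
  have hxm : x ∈ Icc c d := ⟨hc2.le, hd1.le⟩
  rcases hcont.strictMonoOn_of_injOn_Icc' hle (hi.mono (hcd.trans inter_subset_right)) with h | h
  · exact mem_of_superset (Icc_mem_nhds (h (left_mem_Icc.2 hle) hxm hc2)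
      (h hxm (right_mem_Icc.2 hle) hd1)) ((intermediate_value_Icc hle hcont).trans himage)
  · exact mem_of_superset (Icc_mem_nhds (h hxm (right_mem_Icc.2 hle) hd1)
      (h (left_mem_Icc.2 hle) hxm hc2)) ((intermediate_value_Icc' hle hcont).trans himage)

/-- An orbit in a homterval may meet C, where the value of τ is arbitrary a priori. Since τ^n is
open at x and τ^(n+1) is continuous there, τ is continuous at τ^n x, so its value is a one-sided
limit. -/
theorem iterate_mem_iterate_hatImage {u v : unitInterval}
    (h : ∀ n, IsEmbedding ((Ioo u v).domRestrict τ^[n])) {x : unitInterval} (hx : x ∈ Ioo u v)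
    (n : ℕ) : τ^[n] x ∈ (hatImage τ)^[n] {x} := by
  have hcont : ∀ n, ContinuousOn τ^[n] (Ioo u v) := fun n =>
    continuousOn_iff_continuous_domRestrict.2 (h n).continuous
  induction n with
  | zero => exact rfl
  | succ n ih =>
    have hc : ContinuousAt τ (τ^[n] x) := by
      have h1 : Tendsto (τ ∘ τ^[n]) (𝓝 x) (𝓝 (τ (τ^[n] x))) := by
        have := (hcont (n + 1)).continuousAt (isOpen_Ioo.mem_nhds hx)
        rw [Function.iterate_succ'] at this
        exact this
      exact (tendsto_map'_iff.2 h1).mono_left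
        (nhds_le_map_of_injOn_Ioo (hcont n) (injOn_iff_injective.2 (h n).injective) hx)
    rw [Function.iterate_succ_apply', Function.iterate_succ_apply']
    exact mem_biUnion ih (self_mem_hat hc)

theorem MarkovPartition.not_exists_isHomterval_of_dense (M : MarkovPartition P)
    (hd : Dense P.orbitSet) : ¬ ∃ J, IsHomterval τ J := by
  rintro ⟨_, ⟨u, v, huv, rfl⟩, h⟩
  have hinf : (Ioo u v ∩ P.orbitSet).Infinite := by
    intro hfin
    obtain ⟨x, ⟨hx, hx'⟩, hxS⟩ := hd.inter_open_nonempty _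
      (isOpen_Ioo.inter hfin.isClosed.isOpen_compl) ((Ioo_infinite huv).sdiff hfin).nonempty
    exact hx' ⟨hx, hxS⟩
  -- The Markov partition has `M.m + 1` points; one more gives the contradiction, at a time when all
  -- chosen points have landed.
  obtain ⟨t, ht, hcard⟩ := hinf.exists_subset_card_eq (M.m + 2)
  have hk : ∀ x : unitInterval, ∃ k, x ∈ t → ∀ n ≥ k, (hatImage τ)^[n] {x} ⊆ range M.part.pt := by
    intro x
    by_cases hx : x ∈ t
    · exact (M.exists_forall_iterate_hatImage_subset (ht hx).2).imp fun _ h _ => h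
    · exact ⟨0, fun h => absurd h hx⟩
  choose k hk using hk
  have hmaps : MapsTo τ^[t.sup k] t (Finset.univ.image M.part.pt : Finset unitInterval) := by
    intro x hx
    obtain ⟨i, hi⟩ := hk x hx _ (Finset.le_sup hx) (iterate_mem_iterate_hatImage h (ht hx).1 _)
    exact Finset.mem_image.2 ⟨i, Finset.mem_univ _, hi⟩
  have hle := Finset.card_le_card_of_injOn _ hmaps
    ((injOn_iff_injective.2 (h (t.sup k)).injective).mono fun x hx => (ht hx).1)
  have := hle.trans Finset.card_image_le
  rw [hcard, Finset.card_univ, Fintype.card_fin] at this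
  omega

theorem exists_subset_openPiece {n : ℕ} {b : IntervalPartition n} {Q : Set unitInterval}
    (hQ : OrdConnected Q) (hdisj : Disjoint Q (range b.pt)) (hne : Q.Nonempty) :
    ∃ i, Q ⊆ b.openPiece i := by
  obtain ⟨x, hx⟩ := hne
  obtain ⟨i, hi⟩ := exists_mem_openPiece b (hdisj.notMem_of_mem_left hx)
  refine ⟨i, fun y hy => ⟨not_le.1 fun h => ?_, not_le.1 fun h => ?_⟩⟩
  · exact hdisj.notMem_of_mem_left (hQ.out hy hx ⟨h, hi.1.le⟩) (mem_range_self _)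
  · exact hdisj.notMem_of_mem_left (hQ.out hx hy ⟨hi.2.le, h⟩) (mem_range_self _)

/-- Backward closure makes the complement of I₁ forward invariant. Each image of Q is then an
interval disjoint from C, so it lies in one piece. -/
theorem MonotonicPartition.iterate_of_subset_compl_orbitSet {Q : Set unitInterval}
    (hQ : IsPreconnected Q) (hS : Q ⊆ P.orbitSetᶜ) (n : ℕ) :
    ContinuousOn τ^[n] Q ∧ (StrictMonoOn τ^[n] Q ∨ StrictAntiOn τ^[n] Q) ∧
      MapsTo τ^[n] Q P.orbitSetᶜ := by
  rcases Q.eq_empty_or_nonempty with rfl | hne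
  · exact ⟨continuousOn_empty _, Or.inl fun _ h => h.elim, fun _ h => h.elim⟩
  induction n with
  | zero => exact ⟨continuousOn_id, Or.inl strictMonoOn_id, hS⟩
  | succ n ih =>
    obtain ⟨h1, h2, h3⟩ := ih
    obtain ⟨l, hl⟩ := exists_subset_openPiece (b := P.part) (hQ.image _ h1).ordConnected
      (disjoint_left.2 fun y hy hC => by
        obtain ⟨x, hx, rfl⟩ := hy
        exact h3 hx (subset_generalizedOrbit _ hC)) (hne.image _)
    have hl' : MapsTo τ^[n] Q (P.part.openPiece l) := mapsTo_iff_image_subset.2 hl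
    rw [Function.iterate_succ']
    refine ⟨(P.continuousOn l).comp h1 hl', ?_, fun x hx hmem => h3 hx
      (mem_orbitSet_of_hat_mem hmem (self_mem_hat (continuousAt_of_mem_openPiece (hl' hx))))⟩
    rcases h2 with h2 | h2 <;> rcases P.strictMonotonic l with h | h
    · exact Or.inl (h.comp h2 hl')
    · exact Or.inr (h.comp_strictMonoOn h2 hl')
    · exact Or.inr (h.comp_strictAntiOn h2 hl')
    · exact Or.inl (h.comp h2 hl')

theorem exists_Ioo_subset_compl_of_not_dense {S : Set unitInterval} (h : ¬ Dense S) :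
    ∃ u v, u < v ∧ Ioo u v ⊆ Sᶜ := by
  rw [dense_iff_inter_open] at h
  push Not at h
  obtain ⟨U, hU, hne, hemp⟩ := h
  obtain ⟨u, v, huv, hsub⟩ := hU.exists_Ioo_subset hne
  exact ⟨u, v, huv, fun x hx hxS => (hemp ▸ (⟨hsub hx, hxS⟩ : x ∈ U ∩ S) : x ∈ (∅ : Set _))⟩

theorem dense_of_not_exists_isHomterval (h : ¬ ∃ J, IsHomterval τ J) : Dense P.orbitSet := by
  by_contra hd
  obtain ⟨u, v, huv, hsub⟩ := exists_Ioo_subset_compl_of_not_dense hd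
  refine h ⟨Ioo u v, ⟨u, v, huv, rfl⟩, fun n => ?_⟩
  obtain ⟨h1, h2, -⟩ := MonotonicPartition.iterate_of_subset_compl_orbitSet isPreconnected_Ioo hsub n
  have hr : OrdConnected (range ((Ioo u v).domRestrict τ^[n])) := by
    rw [range_domRestrict]
    exact (isPreconnected_Ioo.image _ h1).ordConnected
  rcases h2 with h2 | h2
  · exact h2.domRestrict.isEmbedding_of_ordConnected (hc := hr)
  · have hm : StrictMono (OrderDual.toDual ∘ (Ioo u v).domRestrict τ^[n]) :=
      fun a b hab => h2 a.2 b.2 hab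
    exact hm.isEmbedding_of_ordConnected (hc := hr.dual)

/-! ### Transitivity -/

/-- A strictly monotonic self-map of an interval is not transitive. -/
theorem exists_invariant_disjoint_of_strictMonoOn_or_strictAntiOn {f : unitInterval → unitInterval}
    {K : Set unitInterval} (hK : OrdConnected K) {u v : unitInterval} (huv : u < v)
    (hsub : Ioo u v ⊆ K) (hmaps : MapsTo f K K) (hf : StrictMonoOn f K ∨ StrictAntiOn f K) :
    ∃ T U V, T ⊆ K ∧ MapsTo f T T ∧ IsOpen U ∧ U.Nonempty ∧ U ⊆ T ∧ IsOpen V ∧ V.Nonempty ∧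
      V ⊆ K ∧ Disjoint T V := by
  rcases hf with hf | hf
  · obtain ⟨x, hx⟩ := exists_between huv
    have hxK := hsub hx
    -- For increasing f, the part of K on the side of x towards which x moves is invariant.
    rcases le_total x (f x) with h | h
    · refine ⟨K ∩ Ioi x, Ioo x v, Ioo u x, inter_subset_left,
        fun z hz => ⟨hmaps hz.1, h.trans_lt (hf hxK hz.1 hz.2)⟩, isOpen_Ioo, nonempty_Ioo.2 hx.2,
        fun z hz => ⟨hsub ⟨hx.1.trans hz.1, hz.2⟩, hz.1⟩, isOpen_Ioo, nonempty_Ioo.2 hx.1,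
        fun z hz => hsub ⟨hz.1, hz.2.trans hx.2⟩, ?_⟩
      exact disjoint_left.2 fun z hz hz' => hz'.2.not_gt hz.2
    · refine ⟨K ∩ Iio x, Ioo u x, Ioo x v, inter_subset_left,
        fun z hz => ⟨hmaps hz.1, (hf hz.1 hxK hz.2).trans_le h⟩, isOpen_Ioo, nonempty_Ioo.2 hx.1,
        fun z hz => ⟨hsub ⟨hz.1, hz.2.trans hx.2⟩, hz.2⟩, isOpen_Ioo, nonempty_Ioo.2 hx.2,
        fun z hz => hsub ⟨hx.1.trans hz.1, hz.2⟩, ?_⟩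
      exact disjoint_left.2 fun z hz hz' => hz'.1.not_gt hz.2
  · obtain ⟨x, hx, hne⟩ : ∃ x ∈ Ioo u v, f x ≠ x := by
      obtain ⟨x, hx⟩ := exists_between huv
      obtain ⟨y, hy⟩ := exists_between hx.2
      have hy' : y ∈ Ioo u v := ⟨hx.1.trans hy.1, hy.2⟩
      by_contra! h
      have := hf (hsub hx) (hsub hy') hy.1
      rw [h x hx, h y hy'] at this
      exact this.not_gt hy.1
    have hxK := hsub hx
    have hyK := hmaps hxK
    have hleft : Ioo u x ⊆ K := fun z hz => hsub ⟨hz.1, hz.2.trans hx.2⟩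
    have hright : Ioo x v ⊆ K := fun z hz => hsub ⟨hx.1.trans hz.1, hz.2⟩
    rcases hne.lt_or_gt with hlt | hlt
    · have hmid : Ioo (f x) x ⊆ K := Ioo_subset_Icc_self.trans (hK.out hyK hxK)
      -- For decreasing f, the open interval between x and f x is invariant if f (f x) does not pass
      -- beyond x; otherwise the part of K outside the closed interval is.
      rcases le_or_gt (f (f x)) x with h | h
      · refine ⟨Ioo (f x) x, Ioo (f x) x, Ioo x v, hmid, fun z hz =>
          ⟨hf (hmid hz) hxK hz.2, (hf hyK (hmid hz) hz.1).trans_le h⟩, isOpen_Ioo,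
          nonempty_Ioo.2 hlt, Subset.rfl, isOpen_Ioo, nonempty_Ioo.2 hx.2, hright, ?_⟩
        exact disjoint_left.2 fun z hz hz' => hz'.1.not_gt hz.2
      · refine ⟨K ∩ (Iio (f x) ∪ Ioi x), Ioo x v, Ioo (f x) x, inter_subset_left, ?_, isOpen_Ioo,
          nonempty_Ioo.2 hx.2, fun z hz => ⟨hright hz, Or.inr hz.1⟩, isOpen_Ioo,
          nonempty_Ioo.2 hlt, hmid, ?_⟩
        · rintro z ⟨hz, hz' | hz'⟩
          · exact ⟨hmaps hz, Or.inr (h.trans (hf hz hyK hz'))⟩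
          · exact ⟨hmaps hz, Or.inl (hf hxK hz hz')⟩
        · exact disjoint_left.2 fun z hz hz' => hz.2.elim hz'.1.not_gt hz'.2.not_gt
    · have hmid : Ioo x (f x) ⊆ K := Ioo_subset_Icc_self.trans (hK.out hxK hyK)
      rcases le_or_gt x (f (f x)) with h | h
      · refine ⟨Ioo x (f x), Ioo x (f x), Ioo u x, hmid, fun z hz =>
          ⟨h.trans_lt (hf (hmid hz) hyK hz.2), hf hxK (hmid hz) hz.1⟩, isOpen_Ioo,
          nonempty_Ioo.2 hlt, Subset.rfl, isOpen_Ioo, nonempty_Ioo.2 hx.1, hleft, ?_⟩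
        exact disjoint_left.2 fun z hz hz' => hz'.2.not_gt hz.1
      · refine ⟨K ∩ (Iio x ∪ Ioi (f x)), Ioo u x, Ioo x (f x), inter_subset_left, ?_, isOpen_Ioo,
          nonempty_Ioo.2 hx.1, fun z hz => ⟨hleft hz, Or.inl hz.2⟩, isOpen_Ioo,
          nonempty_Ioo.2 hlt, hmid, ?_⟩
        · rintro z ⟨hz, hz' | hz'⟩
          · exact ⟨hmaps hz, Or.inr (hf hz hxK hz')⟩
          · exact ⟨hmaps hz, Or.inl ((hf hyK hz hz').trans h)⟩
        · exact disjoint_left.2 fun z hz hz' => hz.2.elim hz'.1.not_gt hz'.2.not_gt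

theorem MonotonicPartition.IsTransitive.dense_orbitSet (h : P.IsTransitive) :
    Dense P.orbitSet := by
  by_contra hd
  obtain ⟨u, v, huv, hsub⟩ := exists_Ioo_subset_compl_of_not_dense hd
  obtain ⟨a, ha⟩ := exists_between huv
  set K := connectedComponentIn P.orbitSetᶜ a
  have hJK : Ioo u v ⊆ K := isPreconnected_Ioo.subset_connectedComponentIn ha hsub
  have hK : IsPreconnected K := isPreconnected_connectedComponentIn
  have hKS : K ⊆ P.orbitSetᶜ := connectedComponentIn_subset _ _
  have hiter := MonotonicPartition.iterate_of_subset_compl_orbitSet hK hKS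
  have hmaps : ∀ n, ∀ x ∈ K, τ^[n] x ∈ K → MapsTo τ^[n] K K := by
    intro n x hx hnx
    obtain ⟨h1, -, h3⟩ := hiter n
    have := (hK.image _ h1).subset_connectedComponentIn (mem_image_of_mem _ hx)
      (mapsTo_iff_image_subset.1 h3)
    rw [← connectedComponentIn_eq hnx] at this
    exact mapsTo_iff_image_subset.2 this
  have hex : ∃ p, 0 < p ∧ MapsTo τ^[p] K K := by
    -- Two disjoint halves of the gap force a positive return time.
    obtain ⟨n, x, hx, -, hnx⟩ := h (Ioo u a) (Ioo a v) isOpen_Ioo isOpen_Ioo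
      (nonempty_Ioo.2 ha.1) (nonempty_Ioo.2 ha.2)
    refine ⟨n, Nat.pos_of_ne_zero ?_, hmaps n x (hJK ⟨hx.1, hx.2.trans ha.2⟩)
      (hJK ⟨ha.1.trans hnx.1, hnx.2⟩)⟩
    rintro rfl
    exact hx.2.not_gt hnx.1
  classical
  set p := Nat.find hex
  obtain ⟨hp0, hp⟩ := Nat.find_spec hex
  -- Going forward by full multiples of p stays in K, so the remainder of n modulo p is a return
  -- time too, and minimality makes it zero.
  have hdvd : ∀ n, ∀ x ∈ K, τ^[n] x ∈ K → p ∣ n := by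
    intro n x hx hnx
    rw [Nat.dvd_iff_mod_eq_zero]
    by_contra hr
    refine Nat.find_min hex (Nat.mod_lt n hp0) ⟨Nat.pos_of_ne_zero hr,
      hmaps _ (τ^[p * (n / p)] x) ?_ ?_⟩
    · rw [Function.iterate_mul]
      exact hp.iterate _ hx
    · rwa [← Function.iterate_add_apply, Nat.mod_add_div]
  obtain ⟨T, U, V, hTK, hT, hU, hUne, hUT, hV, hVne, hVK, hdisj⟩ :=
    exists_invariant_disjoint_of_strictMonoOn_or_strictAntiOn hK.ordConnected huv hJK hp
      (hiter p).2.1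
  obtain ⟨n, x, hx, -, hnx⟩ := h U V hU hV hUne hVne
  obtain ⟨q, rfl⟩ := hdvd n x (hTK (hUT hx)) (hVK hnx)
  rw [Function.iterate_mul] at hnx
  exact hdisj.notMem_of_mem_left (hT.iterate q (hUT hx)) hnx

end IntervalMap

theorem proposition1p83 (τ : unitInterval → unitInterval)
    (P : IntervalMap.MonotonicPartition τ) (M : IntervalMap.MarkovPartition P) :
    List.TFAE
      [¬ ∃ J : Set unitInterval, IntervalMap.IsHomterval τ J,
       Function.Injective M.itinerary,
       IntervalMap.IsConjugate P.localHomeo (IntervalMap.shift M.incidence)] ∧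
    (P.IsTransitive →
      (¬ ∃ J : Set unitInterval, IntervalMap.IsHomterval τ J) ∧
      Function.Injective M.itinerary ∧
      IntervalMap.IsConjugate P.localHomeo (IntervalMap.shift M.incidence)) := by
  refine ⟨?_, fun h => ?_⟩
  · tfae_have 1 → 2 := fun h =>
      M.itinerary_injective_of_dense (IntervalMap.dense_of_not_exists_isHomterval h)
    tfae_have 2 → 3 := M.isConjugate_of_injective
    tfae_have 3 → 1 := fun h => M.not_exists_isHomterval_of_dense (M.dense_of_isConjugate h)
    tfae_finish
  · have hd := h.dense_orbitSet
    have hi := M.itinerary_injective_of_dense hd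
    exact ⟨M.not_exists_isHomterval_of_dense hd, hi, M.isConjugate_of_injective hi⟩
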